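/- Let $\mathbf F$ be a finite field with $q$ elements, and let $U_n$ be the group of upper triangular $n\times n$ matrices over $\mathbf F$ with all diagonal entries equal to $1$. For a finite group $G$ and a rational number $r$ let $N_r(G)$ be the number of irreducible complex characters $\chi$ of $G$ with $\chi(1)=r$ (so $N_r(G)=0$ if $r$ is not a positive integer). For $1\le i\le n$ let $P_{n,i}$ be the subgroup of all $A=(a_{x,y})\in U_n$ whose $i$-th column has no nonzero entry except $a_{i,i}=1$, and for $1\le i<j\le n$ let $$Q_{n,i,j}=\{A\in U_n \mid a_{y,i}=0 \text{ for } 1\le y<i,\ \text{ and } a_{x,j}=0 \text{ for } 1\le x<j,\ x\ne i\}.$$ (a) For all $n\ge 4$ and all integers $k$, $$\begin{aligned}N_k(U_n)={}& qN_k(U_{n-1})+N_{k/q}(U_{n-1})-N_{k/q}(U_{n-2})\\ &+(q-1)^2\sum_{1\le i_2<i_1\le n-2}N_{k/q^{i_1+i_2-1}}(P_{n-2,i_1}\cap P_{n-2,i_2})\\ &+(q-1)^2\sum_{1\le i_1<i_2\le n-2}N_{k/q^{i_1+i_2-2}}(Q_{n-2,i_1,i_2}).\end{aligned}$$ (b)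 For all $n\ge 5$ and all integers $k$, $$\begin{aligned}N_k(U_n)={}& qN_k(U_{n-1})+qN_{k/q}(U_{n-1})-qN_{k/q}(U_{n-2})\\ &+(q-1)\bigl[N_{k/q^{n-2}}(U_{n-2})-qN_{k/q^{n-2}}(U_{n-3})+qN_{k/q^{n-3}}(U_{n-2})-qN_{k/q^{n-3}}(U_{n-3})\bigr]\\ &+(q-1)^2\sum_{2\le i_2<i_1\le n-3}N_{k/q^{i_1+i_2-1}}(P_{n-2,i_1}\cap P_{n-2,i_2})\\ &+(q-1)^2\sum_{\substack{1\le i_1<i_2\le n-3\\ (i_1,i_2)\ne(1,2)}}N_{k/q^{i_1+i_2-2}}(Q_{n-2,i_1,i_2}).\end{aligned}$$ -/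

import Mathlib

/-- The set `Irr(G)` of irreducible complex characters of a group `G`: the functions `G → ℂ` that
are traces of irreducible finite-dimensional complex representations of `G`. -/
def irrChars (G : Type*) [Group G] : Set (G → ℂ) :=
  {χ | ∃ (d : ℕ) (ρ : Representation ℂ G (Fin d → ℂ)), ρ.IsIrreducible ∧ ρ.character = χ}

/-- `numIrr G r` is `N_r(G)`, the number of irreducible complex characters `χ` of `G` with
`χ(1) = r`. The degree `r` is allowed to be any rational number; there is no such character when
`r` is not a positive integer. -/
noncomputable def numIrr (G : Type*) [Group G] (r : ℚ) : ℕ :=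
  {χ : G → ℂ | χ ∈ irrChars G ∧ χ 1 = (r : ℂ)}.ncard

/-- If `R` is a transitive relation on the index set that contains `<`-increasing pairs only,
then matrices with unit diagonal whose off-diagonal entries vanish outside `R` are closed under
multiplication. -/
theorem unitri_mul_aux {F : Type*} [Field F] {n : ℕ} (R : Fin n → Fin n → Prop)
    (hlt : ∀ x y, R x y → x < y) (htr : ∀ x y z, R x y → R y z → R x z)
    (A B : Matrix (Fin n) (Fin n) F)
    (hA : (∀ x, A x x = 1) ∧ ∀ x y, x ≠ y → ¬ R x y → A x y = 0)
    (hB : (∀ x, B x x = 1) ∧ ∀ x y, x ≠ y → ¬ R x y → B x y = 0) :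
    (∀ x, (A * B) x x = 1) ∧ ∀ x y, x ≠ y → ¬ R x y → (A * B) x y = 0 := by
  constructor
  · intro x
    rw [Matrix.mul_apply, Finset.sum_eq_single x]
    · rw [hA.1, hB.1, one_mul]
    · intro z _ hz
      by_cases h1 : R x z
      · have h2 : ¬ R z x := fun h => lt_asymm (hlt _ _ h1) (hlt _ _ h)
        rw [hB.2 z x hz h2, mul_zero]
      · rw [hA.2 x z hz.symm h1, zero_mul]
    · intro h
      exact absurd (Finset.mem_univ x) h
  · intro x y hxy hR
    rw [Matrix.mul_apply]
    refine Finset.sum_eq_zero fun z _ => ?_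
    by_cases hxz : x = z
    · subst hxz
      rw [hB.2 x y hxy hR, mul_zero]
    by_cases h1 : R x z
    · by_cases hzy : z = y
      · subst hzy
        exact absurd h1 hR
      · have h2 : ¬ R z y := fun h => hR (htr _ _ _ h1 h)
        rw [hB.2 z y hzy h2, mul_zero]
    · rw [hA.2 x z hxz h1, zero_mul]

/-- The subgroup of `GL_n(F)`, `F` a finite field, that consists of the matrices with unit diagonal
whose nonzero off-diagonal entries lie at positions of the closed pattern `R`. -/
def patternGroup (F : Type*) [Field F] [Finite F] (n : ℕ) (R : Fin n → Fin n → Prop)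
    (hlt : ∀ x y, R x y → x < y) (htr : ∀ x y z, R x y → R y z → R x z) :
    Subgroup (GL (Fin n) F) :=
  { carrier := {A | (∀ x, A.1 x x = 1) ∧ ∀ x y, x ≠ y → ¬ R x y → A.1 x y = 0}
    mul_mem' := fun {A B} hA hB => unitri_mul_aux R hlt htr A.1 B.1 hA hB
    one_mem' := ⟨fun x => Matrix.one_apply_eq x, fun _ _ h _ => Matrix.one_apply_ne h⟩
    inv_mem' := by
      intro A hA
      have hfin : Finite (GL (Fin n) F) := inferInstance
      have key : ∀ m : ℕ, (∀ x, (A ^ m).1 x x = 1) ∧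
          ∀ x y, x ≠ y → ¬ R x y → (A ^ m).1 x y = 0 := by
        intro m
        induction m with
        | zero =>
          rw [pow_zero]
          exact ⟨fun x => Matrix.one_apply_eq x, fun _ _ h _ => Matrix.one_apply_ne h⟩
        | succ m ih =>
          rw [pow_succ]
          exact unitri_mul_aux R hlt htr _ A.1 ih hA
      have hinv : A⁻¹ = A ^ (orderOf A - 1) := by
        rw [inv_eq_iff_mul_eq_one, ← pow_succ', Nat.sub_add_cancel (orderOf_pos A),
          pow_orderOf_eq_one]
      rw [hinv]
      exact key _ }

/-- The group `U_n` of upper unitriangular `n × n` matrices over the finite field `F`. -/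
def unitri (F : Type*) [Field F] [Finite F] (n : ℕ) : Subgroup (GL (Fin n) F) :=
  patternGroup F n (fun x y => x < y) (fun _ _ h => h) (fun _ _ _ h1 h2 => lt_trans h1 h2)

/-- The group `P_{n,i}` of those `A ∈ U_n` whose `i`-th column is trivial. Rows and columns are
numbered from `1`, so the index `y : Fin n` stands for the column with number `y + 1`. -/
def colTriv (F : Type*) [Field F] [Finite F] (n i : ℕ) : Subgroup (GL (Fin n) F) :=
  patternGroup F n (fun x y => x < y ∧ (y : ℕ) + 1 ≠ i) (fun _ _ h => h.1)
    (fun _ _ _ h1 h2 => ⟨lt_trans h1.1 h2.1, h2.2⟩)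

/-- The group `Q_{n,i,j}`, `i < j`, of those `A ∈ U_n` with `a_{y,i} = 0` for all `y < i` and
`a_{x,j} = 0` for all `x < j` with `x ≠ i`. Rows and columns are numbered from `1`. -/
def twoColTriv (F : Type*) [Field F] [Finite F] (n i j : ℕ) : Subgroup (GL (Fin n) F) :=
  patternGroup F n
    (fun x y => x < y ∧ (y : ℕ) + 1 ≠ i ∧ ((y : ℕ) + 1 = j → (x : ℕ) + 1 = i))
    (fun _ _ h => h.1)
    (fun _ _ _ h1 h2 =>
      ⟨lt_trans h1.1 h2.1, h2.2.1, fun h => absurd (h2.2.2 h) h1.2.1⟩)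

theorem mem_unitri {F : Type*} [Field F] [Finite F] {n : ℕ} {A : GL (Fin n) F} :
    A ∈ unitri F n ↔ (∀ x, A.1 x x = 1) ∧ ∀ x y, y < x → A.1 x y = 0 := by
  refine and_congr_right fun _ => ⟨fun h x y hxy => h x y hxy.ne' hxy.not_gt, fun h x y h1 h2 => ?_⟩
  exact h x y (lt_of_le_of_ne (not_lt.mp h2) h1.symm)

theorem mem_colTriv {F : Type*} [Field F] [Finite F] {n i : ℕ} {A : GL (Fin n) F} :
    A ∈ colTriv F n i ↔
      A ∈ unitri F n ∧ ∀ x y : Fin n, (y : ℕ) + 1 = i → x ≠ y → A.1 x y = 0 := by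
  constructor
  · rintro ⟨h1, h2⟩
    exact ⟨⟨h1, fun x y hxy hR => h2 x y hxy fun h => hR h.1⟩,
      fun x y hy hxy => h2 x y hxy fun h => h.2 hy⟩
  · rintro ⟨⟨h1, h2⟩, h3⟩
    refine ⟨h1, fun x y hxy hR => ?_⟩
    by_cases hy : (y : ℕ) + 1 = i
    · exact h3 x y hy hxy
    · exact h2 x y hxy fun h => hR ⟨h, hy⟩

theorem mem_twoColTriv {F : Type*} [Field F] [Finite F] {n i j : ℕ}
    {A : GL (Fin n) F} :
    A ∈ twoColTriv F n i j ↔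
      A ∈ unitri F n ∧ (∀ x y : Fin n, (y : ℕ) + 1 = i → (x : ℕ) + 1 < i → A.1 x y = 0) ∧
        ∀ x y : Fin n, (y : ℕ) + 1 = j → (x : ℕ) + 1 < j → (x : ℕ) + 1 ≠ i → A.1 x y = 0 := by
  constructor
  · rintro ⟨h1, h2⟩
    refine ⟨⟨h1, fun x y hxy hR => h2 x y hxy fun h => hR h.1⟩, fun x y hy hx => ?_,
      fun x y hy hx hxi => ?_⟩
    · exact h2 x y (fun h => by subst h; omega) fun h => h.2.1 hy
    · exact h2 x y (fun h => by subst h; omega) fun h => hxi (h.2.2 hy)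
  · rintro ⟨⟨h1, h2⟩, h3, h4⟩
    refine ⟨h1, fun x y hxy hR => ?_⟩
    by_cases hlt : x < y
    · have hlt' : (x : ℕ) < y := hlt
      by_cases hi : (y : ℕ) + 1 = i
      · exact h3 x y hi (by omega)
      by_cases hj : (y : ℕ) + 1 = j
      · by_cases hxi : (x : ℕ) + 1 = i
        · exact absurd ⟨hlt, hi, fun _ => hxi⟩ hR
        · exact h4 x y hj (by omega) hxi
      · exact absurd ⟨hlt, hi, fun h => absurd h hj⟩ hR
    · exact h2 x y hxy hlt

/-! The engine is the little group method for a semidirect product `H ⋉ A` with `A` abelian: an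
irreducible character of the product is determined by an `H`-orbit of characters of `A`, together
with an irreducible character of the stabilizer of a point of that orbit. Its degree is the orbit
length times the degree of the stabilizer character (`DualSplitting.numIrr_eq_sum`). Injectivity
comes from Fourier inversion along the cosets of `A`, surjectivity from an irreducible piece of an
induced representation.

This is applied with `A` the first row of a pattern group and `H` the group left when the first row
and column are deleted. A fixed nontrivial additive character of the field identifies the characters
of `A` with column vectors, on which `H` acts by left multiplication. If the pattern has all upper
triangular positions between members of the first row, the nonzero orbits are represented by the
vectors `c e_j` with `c ≠ 0`. The stabilizer of `c e_j` is again a pattern group, with column `j`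
cleared in the rows that occur in the first row, and does not depend on `c`; hence the factor `q -
1` in `numIrr_patternGroup_succ`.

For `U_{m+1}` the stabilizers are the groups `P_{m,j}`. For `P_{m+1,i+1}` they are `P_{m,i} ∩
P_{m,j}` when `j < i` and `Q_{m,i,j}` when `i < j`. Using the first recursion, then the second for
each resulting `P`, and finally the first one backwards to sum the remaining terms `N(P_{m,i})`,
gives (a).

Part (b) evaluates the border terms of (a). Column 1 is trivial anyway, a trivial last column can be
deleted, a last column with a single free entry in row `i` is a direct factor, and `Q_{m,1,2}` is
`U_m`. All but the last of these again lead to sums over the groups `P` that collapse. -/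

open Function

/-! ### Irreducible representations, Schur's lemma and finiteness of Irr(G) -/

section Irreducible

variable {G V W : Type*} [Group G] [AddCommGroup V] [Module ℂ V] [AddCommGroup W] [Module ℂ W]

theorem Representation.isIrreducible_of_forall (ρ : Representation ℂ G V) [Nontrivial V]
    (h : ∀ N : Submodule ℂ V, (∀ g, ∀ v ∈ N, ρ g v ∈ N) → N ≠ ⊥ → N = ⊤) :
    ρ.IsIrreducible where
  exists_pair_ne := ⟨⊥, ⊤, fun e => by
    have := congrArg Subrepresentation.toSubmodule e
    exact bot_ne_top (α := Submodule ℂ V) this⟩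
  eq_bot_or_eq_top N := by
    by_cases hN : N.toSubmodule = ⊥
    · exact Or.inl (Subrepresentation.toSubmodule_injective hN)
    · exact Or.inr (Subrepresentation.toSubmodule_injective
        (h N.toSubmodule (fun g v hv => N.apply_mem_toSubmodule g hv) hN))

theorem Representation.IsIrreducible.eq_top {ρ : Representation ℂ G V} (hρ : ρ.IsIrreducible)
    (N : Submodule ℂ V) (hN : ∀ g, ∀ v ∈ N, ρ g v ∈ N) (h0 : N ≠ ⊥) : N = ⊤ := by
  rcases hρ.eq_bot_or_eq_top ⟨N, fun g v hv => hN g v hv⟩ with h | h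
  · exact absurd (congrArg Subrepresentation.toSubmodule h) h0
  · exact congrArg Subrepresentation.toSubmodule h

theorem Representation.IsIrreducible.nontrivial_space {ρ : Representation ℂ G V}
    (hρ : ρ.IsIrreducible) : Nontrivial V := by
  by_contra hV
  rw [not_nontrivial_iff_subsingleton] at hV
  obtain ⟨a, b, hab⟩ := hρ.exists_pair_ne
  exact hab (Subrepresentation.toSubmodule_injective (Subsingleton.elim _ _))

theorem Representation.IsIrreducible.of_equiv {ρ : Representation ℂ G V}
    {σ : Representation ℂ G W} (hρ : ρ.IsIrreducible) (e : V ≃ₗ[ℂ] W)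
    (he : ∀ g v, e (ρ g v) = σ g (e v)) : σ.IsIrreducible := by
  have := hρ.nontrivial_space
  have : Nontrivial W := e.symm.nontrivial
  refine σ.isIrreducible_of_forall fun N hN h0 => ?_
  have hc : N.comap e.toLinearMap = ⊤ := by
    refine hρ.eq_top _ (fun g v hv => ?_) fun hbot => h0 ?_
    · change e (ρ g v) ∈ N
      rw [he]
      exact hN g _ hv
    · rw [eq_bot_iff]
      intro w hw
      have : e.symm w ∈ N.comap e.toLinearMap := by simpa using hw
      rw [hbot, Submodule.mem_bot] at this
      simpa using this
  rw [eq_top_iff]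
  intro w _
  have : e.symm w ∈ N.comap e.toLinearMap := by rw [hc]; trivial
  simpa using this

/-- The trace of an irreducible representation on any finite-dimensional space is an irreducible
character. -/
theorem character_mem_irrChars [FiniteDimensional ℂ V] (ρ : Representation ℂ G V)
    (hρ : ρ.IsIrreducible) : ρ.character ∈ irrChars G := by
  let e : V ≃ₗ[ℂ] (Fin (Module.finrank ℂ V) → ℂ) := (Module.finBasis ℂ V).equivFun
  let σ : Representation ℂ G (Fin (Module.finrank ℂ V) → ℂ) :=
    { toFun := fun g => e.conj (ρ g)
      map_one' := by ext; simp
      map_mul' := fun g h => by rw [map_mul]; exact e.conj_comp _ _ }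
  have he : ∀ g v, e (ρ g v) = σ g (e v) := fun g v => by
    change _ = e.conj (ρ g) (e v)
    simp [LinearEquiv.conj_apply]
  refine ⟨_, σ, hρ.of_equiv e he, ?_⟩
  funext g
  exact LinearMap.trace_conj' (ρ g) e

/-- Schur: kernel and range are invariant subspaces, so a nonzero intertwiner is bijective and
conjugates one action into the other. -/
theorem character_eq_of_intertwining {ρ : Representation ℂ G V} {σ : Representation ℂ G W}
    (hρ : ρ.IsIrreducible) (hσ : σ.IsIrreducible) (f : V →ₗ[ℂ] W)
    (hf : ∀ g v, f (ρ g v) = σ g (f v)) (h0 : f ≠ 0) : ρ.character = σ.character := by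
  have hker : LinearMap.ker f = ⊥ := by
    by_contra hne
    refine h0 (LinearMap.ker_eq_top.mp (hρ.eq_top _ (fun g v hv => ?_) hne))
    rw [LinearMap.mem_ker] at hv ⊢
    rw [hf, hv, map_zero]
  have hran : LinearMap.range f = ⊤ := by
    refine hσ.eq_top _ ?_ fun h => h0 (LinearMap.range_eq_bot.mp h)
    rintro g _ ⟨v, rfl⟩
    exact ⟨ρ g v, hf g v⟩
  let e := LinearEquiv.ofBijective f ⟨LinearMap.ker_eq_bot.mp hker, LinearMap.range_eq_top.mp hran⟩
  funext g
  have : σ g = e.conj (ρ g) := by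
    ext w
    obtain ⟨v, rfl⟩ := e.surjective w
    rw [LinearEquiv.conj_apply]
    simp only [LinearMap.comp_apply, LinearEquiv.coe_coe, LinearEquiv.symm_apply_apply]
    exact (hf g v).symm
  rw [Representation.character, Representation.character, this]
  exact (LinearMap.trace_conj' (ρ g) e).symm

/-- Orthonormality makes distinct irreducible characters linearly independent in the
finite-dimensional space `G → ℂ`. Finiteness matters because `ncard` of an infinite set is the
default value 0, so counts of disjoint unions add only for finite sets. -/
theorem irrChars_finite (G : Type*) [Group G] [Finite G] : (irrChars G).Finite := by
  classical
  have := Fintype.ofFinite G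
  have hc : (Nat.card G : ℂ) ≠ 0 := Nat.cast_ne_zero.mpr Nat.card_pos.ne'
  let _ : Invertible (Nat.card G : ℂ) := invertibleOfNonzero hc
  have horth : ∀ χ ∈ irrChars G, ∀ ψ ∈ irrChars G,
      (Nat.card G : ℂ)⁻¹ * ∑ g, χ g * ψ g⁻¹ = if χ = ψ then 1 else 0 := by
    rintro _ ⟨d, ρ, hρ, rfl⟩ _ ⟨d', σ, hσ, rfl⟩
    rw [Representation.char_orthonormal ρ σ]
    by_cases h : Nonempty (σ.Equiv ρ)
    · rw [if_pos h, if_pos (Representation.char_iso h.some).symm]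
    · rw [if_neg h, if_neg]
      -- Equal characters of inequivalent representations would have inner product both 0 and 1.
      intro he
      have h1 := Representation.char_orthonormal ρ σ
      have h2 := Representation.char_orthonormal ρ ρ
      rw [if_neg h] at h1
      rw [if_pos ⟨Representation.Equiv.refl ρ⟩] at h2
      rw [← he, h2] at h1
      exact one_ne_zero h1
  have hli : LinearIndependent ℂ (fun χ : irrChars G => (χ : G → ℂ)) := by
    rw [linearIndependent_iff']
    intro s c hs χ hχ
    have h1 : ∑ ψ ∈ s, c ψ * ((Nat.card G : ℂ)⁻¹ * ∑ g, ψ.1 g * χ.1 g⁻¹) = 0 := by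
      have h2 : ∀ g, ∑ ψ ∈ s, c ψ * ψ.1 g = 0 := fun g => by
        simpa using congrFun hs g
      calc _ = (Nat.card G : ℂ)⁻¹ * ∑ g, (∑ ψ ∈ s, c ψ * ψ.1 g) * χ.1 g⁻¹ := by
            simp_rw [Finset.sum_mul, Finset.mul_sum]
            rw [Finset.sum_comm]
            exact Finset.sum_congr rfl fun _ _ => Finset.sum_congr rfl fun _ _ => by ring
        _ = 0 := by simp [h2]
    rw [Finset.sum_eq_single χ] at h1
    · rw [horth _ χ.2 _ χ.2, if_pos rfl, mul_one] at h1
      exact h1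
    · intro ψ _ hne
      rw [horth _ ψ.2 _ χ.2, if_neg (fun h => hne (Subtype.ext h)), mul_zero]
    · exact fun h => absurd hχ h
  exact hli.setFinite
end Irreducible

/-! ### Semidirect products with abelian kernel: isotypic projections -/

/-- Data presenting `G` as a semidirect product of an abelian normal subgroup `A` by `H`, together
with an `H`-set `X` that parametrizes equivariantly the complex characters of `A`. -/
structure DualSplitting (G H A X : Type*) [Group G] [Group H] [AddCommGroup A]
    [MulAction H X] where
  incl : A → G
  incl_add : ∀ a b, incl (a + b) = incl a * incl b
  sec : H →* G
  bijective_mul : Bijective fun p : H × A => sec p.1 * incl p.2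
  conj : H → A → A
  sec_mul_incl : ∀ h a, sec h * incl a = incl (conj h a) * sec h
  dual : X → AddChar A ℂ
  dual_bijective : Bijective dual
  dual_smul : ∀ h x a, dual (h • x) (conj h a) = dual x a

namespace DualSplitting

variable {G H A X : Type*} [Group G] [Group H] [AddCommGroup A] [MulAction H X]
  (D : DualSplitting G H A X)

theorem incl_zero : D.incl 0 = 1 := by
  have := D.incl_add 0 0
  rwa [add_zero, left_eq_mul] at this

theorem incl_injective : Injective D.incl := fun a b h => by
  have := D.bijective_mul.injective (a₁ := (1, a)) (a₂ := (1, b)) (congrArg (D.sec 1 * ·) h)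
  exact congrArg Prod.snd this

theorem conj_injective (h : H) : Injective (D.conj h) := fun a b hab => by
  have h1 := D.sec_mul_incl h a
  rw [hab, ← D.sec_mul_incl] at h1
  exact D.incl_injective (mul_left_cancel h1)

theorem conj_neg (h : H) (a : A) : D.conj h (-a) = - D.conj h a := by
  rw [eq_neg_iff_add_eq_zero]
  apply D.incl_injective
  rw [D.incl_add, ← mul_left_inj (D.sec h), mul_assoc, ← D.sec_mul_incl, ← mul_assoc,
    ← D.sec_mul_incl, mul_assoc, ← D.incl_add, neg_add_cancel, D.incl_zero, mul_one, one_mul]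

variable [Fintype A]

theorem sum_conj {M : Type*} [AddCommMonoid M] (h : H) (f : A → M) :
    ∑ a, f (D.conj h a) = ∑ a, f a :=
  Fintype.sum_bijective _ (Finite.injective_iff_bijective.mp (D.conj_injective h)) _ _
    fun _ => rfl

theorem card_ne_zero : (Fintype.card A : ℂ) ≠ 0 := Nat.cast_ne_zero.mpr Fintype.card_ne_zero

omit [Fintype A] in
theorem dual_neg_mul (x : X) (a : A) :
    D.dual x (-a) * D.dual x a = 1 := by
  rw [← AddChar.map_add_eq_mul, neg_add_cancel, AddChar.map_zero_eq_one]

section Projections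

variable {V : Type*} [AddCommGroup V] [Module ℂ V] (ρ : Representation ℂ G V)

/-- The projection of a representation of `G` onto the isotypic component of a character of
`A`. -/
noncomputable def proj (x : X) : V →ₗ[ℂ] V :=
  (Fintype.card A : ℂ)⁻¹ • ∑ a, D.dual x (-a) • ρ (D.incl a)

theorem proj_apply (x : X) (v : V) :
    D.proj ρ x v = (Fintype.card A : ℂ)⁻¹ • ∑ a, D.dual x (-a) • ρ (D.incl a) v := by
  simp [proj]

theorem rho_incl_proj (x : X) (a : A) (v : V) :
    ρ (D.incl a) (D.proj ρ x v) = D.dual x a • D.proj ρ x v := by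
  rw [proj_apply, map_smul, map_sum, smul_comm (D.dual x a)]
  congr 1
  rw [Finset.smul_sum]
  refine Fintype.sum_equiv (Equiv.addLeft a) _ _ fun b => ?_
  rw [map_smul, smul_smul, Equiv.coe_addLeft, D.incl_add, map_mul, Module.End.mul_apply, neg_add,
    AddChar.map_add_eq_mul, ← mul_assoc, mul_comm (D.dual x a), D.dual_neg_mul, one_mul]

theorem proj_of_eigen {x : X} {v : V} (hv : ∀ a, ρ (D.incl a) v = D.dual x a • v) :
    D.proj ρ x v = v := by
  simp_rw [proj_apply, hv, smul_smul, D.dual_neg_mul, one_smul, Finset.sum_const,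
    Finset.card_univ, ← Nat.cast_smul_eq_nsmul ℂ, smul_smul, inv_mul_cancel₀ (card_ne_zero (A := A)),
    one_smul]

theorem proj_of_eigen_ne {x y : X} (hxy : x ≠ y) {v : V}
    (hv : ∀ a, ρ (D.incl a) v = D.dual x a • v) : D.proj ρ y v = 0 := by
  have h1 : D.dual x - D.dual y ≠ 0 := sub_ne_zero.mpr (D.dual_bijective.injective.ne hxy)
  have h2 := (AddChar.sum_eq_zero_iff_ne_zero (ψ := D.dual x - D.dual y)).mpr h1
  simp_rw [proj_apply, hv, smul_smul, ← Finset.sum_smul]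
  rw [← smul_zero (Fintype.card A : ℂ)⁻¹]
  congr 1
  rw [← zero_smul ℂ v, ← h2]
  congr 1
  refine Finset.sum_congr rfl fun a _ => ?_
  rw [AddChar.sub_apply', AddChar.map_neg_eq_inv, mul_comm, div_eq_mul_inv]

theorem proj_proj (x : X) (v : V) : D.proj ρ x (D.proj ρ x v) = D.proj ρ x v :=
  D.proj_of_eigen ρ fun a => D.rho_incl_proj ρ x a v

theorem proj_proj_of_ne {x y : X} (hxy : x ≠ y) (v : V) : D.proj ρ y (D.proj ρ x v) = 0 :=
  D.proj_of_eigen_ne ρ hxy fun a => D.rho_incl_proj ρ x a v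

/-- Conjugation by `h` permutes `A` and transports the character `x` to `h • x`, so `h` carries the
`x`-component to the `h • x`-component. -/
theorem rho_sec_proj (h : H) (x : X) (v : V) :
    ρ (D.sec h) (D.proj ρ x v) = D.proj ρ (h • x) (ρ (D.sec h) v) := by
  rw [proj_apply, proj_apply, map_smul, map_sum,
    ← D.sum_conj h fun a => D.dual (h • x) (-a) • ρ (D.incl a) (ρ (D.sec h) v)]
  congr 1
  refine Finset.sum_congr rfl fun a _ => ?_
  rw [map_smul, ← D.conj_neg, D.dual_smul, ← Module.End.mul_apply, ← Module.End.mul_apply,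
    ← map_mul, ← map_mul, D.sec_mul_incl]

variable [Fintype X]

theorem sum_dual [DecidableEq A] (a : A) :
    ∑ x : X, D.dual x a = if a = 0 then (Fintype.card A : ℂ) else 0 := by
  classical
  rw [← AddChar.sum_apply_eq_ite]
  exact Fintype.sum_bijective _ D.dual_bijective _ _ fun _ => rfl

theorem sum_proj (v : V) : ∑ x, D.proj ρ x v = v := by
  classical
  simp_rw [proj_apply]
  rw [← Finset.smul_sum, Finset.sum_comm]
  simp_rw [← Finset.sum_smul, D.sum_dual, neg_eq_zero, ite_smul, zero_smul]
  rw [Finset.sum_ite_eq' Finset.univ, if_pos (Finset.mem_univ _), D.incl_zero, map_one, smul_smul,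
    inv_mul_cancel₀ (card_ne_zero (A := A)), one_smul]
  rfl

theorem exists_proj_ne_zero [Nontrivial V] : ∃ x, D.proj ρ x ≠ 0 := by
  by_contra! h
  obtain ⟨v, hv⟩ := exists_ne (0 : V)
  apply hv
  rw [← D.sum_proj ρ v]
  simp [h]

omit [Fintype A] [Fintype X] in
theorem exists_sec_mul_incl (g : G) : ∃ h a, D.sec h * D.incl a = g := by
  obtain ⟨⟨h, a⟩, hg⟩ := D.bijective_mul.surjective g
  exact ⟨h, a, hg⟩

omit [Fintype X] in
/-- If an irreducible representation has nonzero components at two characters of `A`, then these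
are conjugate. -/
theorem mem_orbit_of_proj_ne_zero (hρ : ρ.IsIrreducible) {x y : X} (hx : D.proj ρ x ≠ 0)
    (hy : D.proj ρ y ≠ 0) : y ∈ MulAction.orbit H x := by
  by_contra hxy
  -- The components over one orbit span a `G`-invariant subspace, hence everything; a projection
  -- outside the orbit kills all of it.
  let N : Submodule ℂ V := ⨆ h : H, LinearMap.range (D.proj ρ (h • x))
  have hN : N = ⊤ := by
    refine hρ.eq_top _ (fun g v hv => ?_) fun h0 => hx ?_
    · obtain ⟨h, a, rfl⟩ := D.exists_sec_mul_incl g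
      induction hv using Submodule.iSup_induction' with
      | mem k v hv =>
        obtain ⟨w, rfl⟩ := hv
        rw [map_mul, Module.End.mul_apply, rho_incl_proj, map_smul, rho_sec_proj, smul_smul]
        exact Submodule.smul_mem _ _ (Submodule.mem_iSup_of_mem (h * k) ⟨_, rfl⟩)
      | zero => simp
      | add v w _ _ hv hw => rw [map_add]; exact N.add_mem hv hw
    · have := (iSup_eq_bot.mp h0) 1
      rwa [one_smul, LinearMap.range_eq_bot] at this
  have hk : N ≤ LinearMap.ker (D.proj ρ y) := by
    refine iSup_le fun h => ?_
    rintro _ ⟨w, rfl⟩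
    exact D.proj_proj_of_ne ρ (fun e => hxy ⟨h, e⟩) w
  rw [hN, top_le_iff, LinearMap.ker_eq_top] at hk
  exact hy hk

/-- The isotypic component of a character of `A`, as a representation of its stabilizer. -/
noncomputable def isoRep (x : X) :
    Representation ℂ (MulAction.stabilizer H x) (LinearMap.range (D.proj ρ x)) where
  toFun h := (ρ (D.sec h)).restrict (by
    rintro _ ⟨v, rfl⟩
    rw [rho_sec_proj, MulAction.mem_stabilizer_iff.mp h.2]
    exact ⟨_, rfl⟩)
  map_one' := by ext; simp
  map_mul' g h := by ext; simp

omit [Fintype X] in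
theorem coe_isoRep_apply (x : X) (h : MulAction.stabilizer H x) (v) :
    (D.isoRep ρ x h v : V) = ρ (D.sec h) v := rfl

-- The `H`-translates of a nonzero stabilizer-invariant `W` span a `G`-invariant space, hence
-- everything. Projected back to the component of `x`, a translate by an element outside the
-- stabilizer vanishes, and the others stay in `W`; so `W` is the whole component.
omit [Fintype X] in
theorem isoRep_isIrreducible (hρ : ρ.IsIrreducible) {x : X} (hx : D.proj ρ x ≠ 0) :
    (D.isoRep ρ x).IsIrreducible := by
  have : Nontrivial (LinearMap.range (D.proj ρ x)) := by
    rw [Submodule.nontrivial_iff_ne_bot]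
    exact fun h => hx (LinearMap.range_eq_bot.mp h)
  refine Representation.isIrreducible_of_forall _ fun W hW h0 => ?_
  let W' : Submodule ℂ V := W.map (LinearMap.range (D.proj ρ x)).subtype
  have hW' : ∀ v ∈ W', D.proj ρ x v = v := by
    rintro _ ⟨⟨_, w, rfl⟩, _, rfl⟩
    exact D.proj_proj ρ x w
  let N : Submodule ℂ V := ⨆ h : H, W'.map (ρ (D.sec h))
  have hN : N = ⊤ := by
    refine hρ.eq_top _ (fun g v hv => ?_) fun h1 => h0 ?_
    · obtain ⟨h, a, rfl⟩ := D.exists_sec_mul_incl g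
      induction hv using Submodule.iSup_induction' with
      | mem k v hv =>
        obtain ⟨w, hw, rfl⟩ := hv
        rw [← hW' w hw, map_mul, Module.End.mul_apply, rho_sec_proj, rho_incl_proj, map_smul,
          ← rho_sec_proj, ← Module.End.mul_apply, ← map_mul, ← map_mul, hW' w hw]
        exact Submodule.smul_mem _ _ (Submodule.mem_iSup_of_mem (h * k) ⟨_, hw, rfl⟩)
      | zero => simp
      | add v w _ _ hv hw => rw [map_add]; exact N.add_mem hv hw
    · have := (iSup_eq_bot.mp h1) 1
      rw [map_one, map_one] at this
      have h2 : W' = ⊥ := by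
        rw [← this]
        exact (Submodule.map_id W').symm
      exact Submodule.map_injective_of_injective Subtype.val_injective
        (h2.trans (Submodule.map_bot _).symm)
  have key : N ≤ W'.comap (D.proj ρ x) := by
    refine iSup_le fun h => ?_
    rintro _ ⟨w, hw, rfl⟩
    rw [Submodule.mem_comap, ← hW' w hw, rho_sec_proj]
    by_cases hh : h • x = x
    · rw [hh, proj_proj, ← hh, ← rho_sec_proj, hW' w hw]
      obtain ⟨w, hw, rfl⟩ := hw
      exact ⟨_, hW ⟨h, hh⟩ w hw, rfl⟩
    · rw [D.proj_proj_of_ne ρ hh]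
      exact W'.zero_mem
  rw [eq_top_iff]
  rintro ⟨_, v, rfl⟩ _
  have hv : v ∈ N := by rw [hN]; trivial
  obtain ⟨w, hw, hwv⟩ := key hv
  have : w = ⟨D.proj ρ x v, v, rfl⟩ := Subtype.ext hwv
  rwa [← this]

end Projections

end DualSplitting

/-! ### Fourier coefficients of characters and the Clifford correspondence -/

namespace DualSplitting

variable {G H A X : Type*} [Group G] [Group H] [AddCommGroup A] [MulAction H X]
  (D : DualSplitting G H A X) [Fintype A]

/-- The Fourier coefficient at the character `x` of `A` of the function `χ` on the coset of `h`. -/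
noncomputable def coeff (χ : G → ℂ) (x : X) (h : H) : ℂ :=
  (Fintype.card A : ℂ)⁻¹ * ∑ a, D.dual x (-a) * χ (D.sec h * D.incl a)

/-- The restriction of the Fourier coefficient to the stabilizer of `x`. -/
noncomputable def stabCoeff (χ : G → ℂ) (x : X) (h : MulAction.stabilizer H x) : ℂ :=
  D.coeff χ x h

section Trace

variable {V : Type*} [AddCommGroup V] [Module ℂ V] (ρ : Representation ℂ G V)

theorem coeff_character (x : X) (h : H) :
    D.coeff ρ.character x h = LinearMap.trace ℂ V (ρ (D.sec h) * D.proj ρ x) := by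
  rw [coeff, proj, mul_smul_comm, map_smul, smul_eq_mul]
  congr 1
  rw [Finset.mul_sum, map_sum]
  refine Finset.sum_congr rfl fun a _ => ?_
  rw [mul_smul_comm, map_smul, ← map_mul, smul_eq_mul, Representation.character]

theorem rho_sec_mul_proj (h : H) (x : X) :
    ρ (D.sec h) * D.proj ρ x = D.proj ρ (h • x) * ρ (D.sec h) :=
  LinearMap.ext (D.rho_sec_proj ρ h x)

theorem proj_mul_self (x : X) : D.proj ρ x * D.proj ρ x = D.proj ρ x :=
  LinearMap.ext (D.proj_proj ρ x)

theorem proj_mul_of_ne {x y : X} (hxy : x ≠ y) : D.proj ρ y * D.proj ρ x = 0 :=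
  LinearMap.ext (D.proj_proj_of_ne ρ hxy)

theorem coeff_character_smul (x : X) (g h : H) :
    D.coeff ρ.character (g • x) h = D.coeff ρ.character x (g⁻¹ * h * g) := by
  have h1 : D.proj ρ (g • x) = ρ (D.sec g) * D.proj ρ x * ρ (D.sec g⁻¹) := by
    rw [rho_sec_mul_proj, mul_assoc, ← map_mul, ← map_mul, mul_inv_cancel, map_one, map_one,
      mul_one]
  rw [coeff_character, coeff_character, h1, ← mul_assoc, LinearMap.trace_mul_comm]
  simp only [mul_assoc, map_mul ρ, map_mul D.sec]

/-- By cyclicity the trace of `ρ(h) p_x = ρ(h) p_x p_x` is that of `p_x p_{h • x} ρ(h)`, where the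
two projections annihilate each other. -/
theorem coeff_character_of_smul_ne {x : X} {h : H} (hx : h • x ≠ x) :
    D.coeff ρ.character x h = 0 := by
  rw [coeff_character, ← proj_mul_self, ← mul_assoc, LinearMap.trace_mul_comm,
    rho_sec_mul_proj, ← mul_assoc, D.proj_mul_of_ne ρ hx, zero_mul, map_zero]

/-- The coefficient is the trace of `ρ(h)` composed with the projection; this operator maps into the
component of `x` and agrees with `ρ(h)` there. -/
theorem stabCoeff_character [FiniteDimensional ℂ V] (x : X) :
    D.stabCoeff ρ.character x = (D.isoRep ρ x).character := by
  funext h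
  have hmap : ∀ v, (ρ (D.sec h) * D.proj ρ x) v ∈ LinearMap.range (D.proj ρ x) := fun v => by
    rw [rho_sec_mul_proj, MulAction.mem_stabilizer_iff.mp h.2]
    exact ⟨_, rfl⟩
  rw [stabCoeff, coeff_character, ← LinearMap.trace_restrict_eq_of_forall_mem _ _ hmap,
    Representation.character]
  congr 1
  ext ⟨_, v, rfl⟩
  rw [coe_isoRep_apply, LinearMap.coe_restrict_apply, Module.End.mul_apply, proj_proj]

theorem coeff_character_one [FiniteDimensional ℂ V] (x : X) :
    D.coeff ρ.character x 1 = Module.finrank ℂ (LinearMap.range (D.proj ρ x)) := by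
  rw [← Representation.char_one (D.isoRep ρ x), ← stabCoeff_character]
  rfl

theorem coeff_character_one_ne_zero [FiniteDimensional ℂ V] {x : X} :
    D.coeff ρ.character x 1 ≠ 0 ↔ D.proj ρ x ≠ 0 := by
  rw [coeff_character_one, Nat.cast_ne_zero, Ne, Submodule.finrank_eq_zero,
    LinearMap.range_eq_bot]

theorem coeff_eq_zero_of_notMem_orbit [FiniteDimensional ℂ V] (hρ : ρ.IsIrreducible) {x y : X}
    (hx : D.coeff ρ.character x 1 ≠ 0) (hy : y ∉ MulAction.orbit H x) (h : H) :
    D.coeff ρ.character y h = 0 := by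
  rw [coeff_character_one_ne_zero] at hx
  have : D.proj ρ y = 0 := by
    by_contra h0
    exact hy (D.mem_orbit_of_proj_ne_zero ρ hρ hx h0)
  rw [coeff_character, this, mul_zero, map_zero]

end Trace

/-- Fourier inversion on the coset of `h`. -/
theorem sum_coeff [Fintype X] (χ : G → ℂ) (h : H) (a : A) :
    ∑ x, D.dual x a * D.coeff χ x h = χ (D.sec h * D.incl a) := by
  classical
  have h1 : ∀ x, D.dual x a * D.coeff χ x h =
      (Fintype.card A : ℂ)⁻¹ * ∑ b, D.dual x (a - b) * χ (D.sec h * D.incl b) := fun x => by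
    rw [coeff, mul_left_comm, Finset.mul_sum]
    congr 1
    refine Finset.sum_congr rfl fun b _ => ?_
    rw [sub_eq_add_neg, AddChar.map_add_eq_mul, mul_assoc]
  simp_rw [h1]
  rw [← Finset.mul_sum, Finset.sum_comm]
  simp_rw [← Finset.sum_mul, D.sum_dual, sub_eq_zero, ite_mul, zero_mul]
  rw [Finset.sum_ite_eq, if_pos (Finset.mem_univ _), ← mul_assoc,
    inv_mul_cancel₀ (card_ne_zero (A := A)), one_mul]

theorem stabCoeff_mem_irrChars {χ : G → ℂ} (hχ : χ ∈ irrChars G) {x : X}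
    (hx : D.coeff χ x 1 ≠ 0) : D.stabCoeff χ x ∈ irrChars (MulAction.stabilizer H x) := by
  obtain ⟨d, ρ, hρ, rfl⟩ := hχ
  rw [stabCoeff_character]
  exact character_mem_irrChars _ (D.isoRep_isIrreducible ρ hρ
    ((D.coeff_character_one_ne_zero ρ).mp hx))

theorem exists_coeff_ne_zero [Fintype X] {χ : G → ℂ} (hχ : χ ∈ irrChars G) :
    ∃ x, D.coeff χ x 1 ≠ 0 := by
  obtain ⟨d, ρ, hρ, rfl⟩ := hχ
  have := hρ.nontrivial_space
  obtain ⟨x, hx⟩ := D.exists_proj_ne_zero ρ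
  exact ⟨x, (D.coeff_character_one_ne_zero ρ).mpr hx⟩

theorem coeff_one_smul {χ : G → ℂ} (hχ : χ ∈ irrChars G) (x : X) (h : H) :
    D.coeff χ (h • x) 1 = D.coeff χ x 1 := by
  obtain ⟨d, ρ, hρ, rfl⟩ := hχ
  rw [coeff_character_smul, mul_one, inv_mul_cancel]

theorem mem_orbit_of_coeff_ne_zero {χ : G → ℂ} (hχ : χ ∈ irrChars G) {x y : X}
    (hx : D.coeff χ x 1 ≠ 0) (hy : D.coeff χ y 1 ≠ 0) : y ∈ MulAction.orbit H x := by
  obtain ⟨d, ρ, hρ, rfl⟩ := hχ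
  by_contra h
  exact hy (D.coeff_eq_zero_of_notMem_orbit ρ hρ hx h 1)

/-- Inversion at the identity writes `χ 1` as the sum of the dimensions of all components; these are
constant on one orbit and zero off it. -/
theorem degree_eq [Fintype X] {χ : G → ℂ} (hχ : χ ∈ irrChars G) {x : X}
    (hx : D.coeff χ x 1 ≠ 0) : χ 1 = Nat.card (MulAction.orbit H x) * D.stabCoeff χ x 1 := by
  classical
  have h1 := D.sum_coeff χ 1 0
  rw [map_one, D.incl_zero, mul_one] at h1
  have h2 : ∀ y, D.dual y 0 * D.coeff χ y 1 =
      if y ∈ MulAction.orbit H x then D.stabCoeff χ x 1 else 0 := fun y => by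
    rw [AddChar.map_zero_eq_one, one_mul]
    split_ifs with hy
    · obtain ⟨h, rfl⟩ := hy
      exact D.coeff_one_smul hχ x h
    · by_contra h0
      exact hy (D.mem_orbit_of_coeff_ne_zero hχ hx h0)
  rw [← h1, Finset.sum_congr rfl fun y _ => h2 y, ← Finset.sum_filter, Finset.sum_const,
    nsmul_eq_mul, Nat.card_eq_fintype_card, Fintype.card_subtype]

/-- Conjugation moves any point of the orbit back to `x`, where the coefficient is given on the
stabilizer and vanishes off it; outside the orbit everything vanishes. -/
theorem coeff_eq_of_stabCoeff_eq {χ χ' : G → ℂ} (hχ : χ ∈ irrChars G) (hχ' : χ' ∈ irrChars G)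
    {x : X} (hx : D.coeff χ x 1 ≠ 0) (h : D.stabCoeff χ x = D.stabCoeff χ' x) (y : X) (g : H) :
    D.coeff χ y g = D.coeff χ' y g := by
  have hx' : D.coeff χ' x 1 ≠ 0 := by
    have := congrFun h 1
    simp only [stabCoeff, OneMemClass.coe_one] at this
    rwa [← this]
  obtain ⟨d, ρ, hρ, rfl⟩ := hχ
  obtain ⟨d', σ, hσ, rfl⟩ := hχ'
  by_cases hy : y ∈ MulAction.orbit H x
  · obtain ⟨k, rfl⟩ := hy
    simp only [coeff_character_smul]
    by_cases hk : (k⁻¹ * g * k) • x = x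
    · exact congrFun h ⟨_, hk⟩
    · rw [D.coeff_character_of_smul_ne ρ hk, D.coeff_character_of_smul_ne σ hk]
  · rw [D.coeff_eq_zero_of_notMem_orbit ρ hρ hx hy, D.coeff_eq_zero_of_notMem_orbit σ hσ hx' hy]

theorem eq_of_stabCoeff_eq [Fintype X] {χ χ' : G → ℂ} (hχ : χ ∈ irrChars G)
    (hχ' : χ' ∈ irrChars G) {x : X} (hx : D.coeff χ x 1 ≠ 0)
    (h : D.stabCoeff χ x = D.stabCoeff χ' x) : χ = χ' := by
  funext g
  obtain ⟨k, a, rfl⟩ := D.exists_sec_mul_incl g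
  rw [← D.sum_coeff χ, ← D.sum_coeff χ']
  exact Finset.sum_congr rfl fun y _ => by rw [D.coeff_eq_of_stabCoeff_eq hχ hχ' hx h]

/-! ### Surjectivity of the correspondence, by induction from the stabilizer -/

section Coinduced

variable {W : Type*} [AddCommGroup W] [Module ℂ W] {x : X}
  (σ : Representation ℂ (MulAction.stabilizer H x) W)

/-- The functions on `G` that transform under the stabilizer of `x` by `σ`, extended by the
character of `A` given by `x`. -/
def coinduced : Submodule ℂ (G → W) where
  carrier := {f | ∀ (t : MulAction.stabilizer H x) a g,
    f (D.sec t * D.incl a * g) = D.dual x a • σ t (f g)}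
  zero_mem' t a g := by simp
  add_mem' hf hf' t a g := by
    simp only [Set.mem_ofPred_eq] at hf hf'
    simp [hf, hf']
  smul_mem' c f hf t a g := by
    simp only [Set.mem_ofPred_eq] at hf
    simp [hf, smul_comm c]

omit [Fintype A] in
theorem coinduced_ne_bot [Nontrivial W] : D.coinduced σ ≠ ⊥ := by
  classical
  obtain ⟨w, hw⟩ := exists_ne (0 : W)
  let e := Equiv.ofBijective _ D.bijective_mul
  -- The transformation law forces the values on the preimage of the stabilizer once `f 1 = w` is
  -- chosen; elsewhere `f` is zero.
  let f : G → W := fun g => if h : (e.symm g).1 • x = x then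
    D.dual x (e.symm g).2 • σ ⟨(e.symm g).1, h⟩ w else 0
  have hf : ∀ h a, f (D.sec h * D.incl a) =
      if h : h • x = x then D.dual x a • σ ⟨_, h⟩ w else 0 := fun h a => by
    have : e.symm (D.sec h * D.incl a) = (h, a) := by
      rw [Equiv.symm_apply_eq]
      rfl
    simp only [f]
    split_ifs with h1 h2 h2
    · simp only [this]
    · exact absurd (by rwa [this] at h1) h2
    · exact absurd (by rwa [this]) h1
    · rfl
  intro h0
  have hmem : f ∈ D.coinduced σ := by
    intro t a g
    obtain ⟨h, b, rfl⟩ := D.exists_sec_mul_incl g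
    have hconj : D.incl a * D.sec h = D.sec h * D.incl (D.conj h⁻¹ a) := by
      rw [← inv_mul_eq_iff_eq_mul, ← mul_assoc, ← map_inv, D.sec_mul_incl, mul_assoc, ← map_mul,
        inv_mul_cancel, map_one, mul_one]
    have hmul : D.sec t * D.incl a * (D.sec h * D.incl b) =
        D.sec (t * h) * D.incl (D.conj h⁻¹ a + b) := by
      rw [D.incl_add, map_mul, mul_assoc, ← mul_assoc (D.incl a), hconj]
      simp only [mul_assoc]
    rw [hmul, hf, hf]
    have ht : (t : H) • x = x := t.2
    by_cases hh : h • x = x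
    · have hth : ((t : H) * h) • x = x := by rw [mul_smul, hh, ht]
      have hh' : h⁻¹ • x = x := by rw [inv_smul_eq_iff, hh]
      -- Moving `a` past `h` conjugates it, which the character of a point fixed by `h` does not
      -- see.
      have hd : D.dual x (D.conj h⁻¹ a) = D.dual x a := by
        conv_lhs => rw [← hh']
        exact D.dual_smul _ _ _
      rw [dif_pos hh, dif_pos hth, AddChar.map_add_eq_mul, hd, map_smul, smul_smul,
        ← Module.End.mul_apply, ← map_mul σ]
      rfl
    · have hth : ((t : H) * h) • x ≠ x := by
        rw [mul_smul]
        exact fun h1 => hh (smul_left_cancel (t : H) (h1.trans ht.symm))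
      rw [dif_neg hh, dif_neg hth, map_zero, smul_zero]
  rw [h0, Submodule.mem_bot] at hmem
  have h1 := hf 1 0
  rw [hmem, dif_pos (one_smul H x), AddChar.map_zero_eq_one, one_smul] at h1
  apply hw
  rw [Pi.zero_apply] at h1
  rw [h1]
  exact (LinearMap.congr_fun σ.map_one w).symm

end Coinduced

/-- Right translation of functions on a group. -/
def rightTranslation (G W : Type*) [Group G] [AddCommGroup W] [Module ℂ W] :
    Representation ℂ G (G → W) where
  toFun g := LinearMap.funLeft ℂ W (· * g)
  map_one' := by ext; simp [LinearMap.funLeft_apply]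
  map_mul' g h := by ext; simp [LinearMap.funLeft_apply, mul_assoc]

/-- A minimal nonzero invariant subspace exists in finite dimension and is irreducible. -/
theorem exists_irreducible_le {G V : Type*} [Group G] [AddCommGroup V] [Module ℂ V]
    [FiniteDimensional ℂ V] (ρ : Representation ℂ G V) (M : Submodule ℂ V)
    (hM : ∀ g, ∀ v ∈ M, ρ g v ∈ M) (h0 : M ≠ ⊥) :
    ∃ N : Subrepresentation ρ, N.toSubmodule ≤ M ∧ N.toRepresentation.IsIrreducible := by
  let S : Set (Submodule ℂ V) := {N | N ≤ M ∧ N ≠ ⊥ ∧ ∀ g, ∀ v ∈ N, ρ g v ∈ N}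
  obtain ⟨N, ⟨hNM, hN0, hNi⟩, hmin⟩ :=
    WellFounded.has_min (wellFounded_lt (α := Submodule ℂ V)) S ⟨M, le_rfl, h0, hM⟩
  refine ⟨⟨N, fun g v hv => hNi g v hv⟩, hNM, ?_⟩
  have : Nontrivial N := (Submodule.nontrivial_iff_ne_bot).mpr hN0
  refine Representation.isIrreducible_of_forall _ fun K hK hK0 => ?_
  by_contra hne
  refine hmin (K.map N.subtype) ⟨(Submodule.map_subtype_le N K).trans hNM, ?_, ?_⟩ ?_
  · intro h
    exact hK0 (Submodule.map_injective_of_injective Subtype.val_injective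
        (h.trans (Submodule.map_bot _).symm))
  · rintro g _ ⟨v, hv, rfl⟩
    exact ⟨_, hK g v hv, rfl⟩
  · refine lt_of_le_of_ne (Submodule.map_subtype_le N K) fun h => hne ?_
    apply Submodule.map_injective_of_injective (f := N.subtype) Subtype.val_injective
    rw [h, Submodule.map_subtype_top]

/-- Frobenius reciprocity: on any irreducible piece of the induced representation, evaluation at 1
is nonzero, intertwines the stabilizer actions and factors through the component of `x`. Schur then
identifies that component with `σ`, with no need to know that the induced representation is itself
irreducible. -/
theorem exists_stabCoeff_eq [Finite G] {x : X} {ψ : MulAction.stabilizer H x → ℂ}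
    (hψ : ψ ∈ irrChars (MulAction.stabilizer H x)) :
    ∃ χ ∈ irrChars G, D.coeff χ x 1 ≠ 0 ∧ D.stabCoeff χ x = ψ := by
  obtain ⟨d, σ, hσ, rfl⟩ := hψ
  have := hσ.nontrivial_space
  obtain ⟨N, hN, hirr⟩ := exists_irreducible_le (rightTranslation G (Fin d → ℂ))
    (D.coinduced σ) (fun g f hf t a u => by
      change f (_ * g) = _ • σ t (f (u * g))
      rw [mul_assoc, hf]) (D.coinduced_ne_bot σ)
  let ρ := N.toRepresentation
  let ev : N.toSubmodule →ₗ[ℂ] (Fin d → ℂ) := (LinearMap.proj 1).comp N.toSubmodule.subtype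
  have hev : ∀ g f, ev (ρ g f) = f.1 g := fun g f => by
    change f.1 (1 * g) = _
    rw [one_mul]
  have hevs : ∀ (t : MulAction.stabilizer H x) f, ev (ρ (D.sec t) f) = σ t (ev f) := fun t f => by
    have h1 := hN f.2 t 0 1
    rw [D.incl_zero, mul_one, mul_one, AddChar.map_zero_eq_one, one_smul] at h1
    rw [hev]
    exact h1
  have heva : ∀ a f, ev (ρ (D.incl a) f) = D.dual x a • ev f := fun a f => by
    have h1 := hN f.2 1 a 1
    rw [OneMemClass.coe_one, map_one, map_one, one_mul, mul_one] at h1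
    rw [hev]
    exact h1
  have hproj : ∀ f, ev (D.proj ρ x f) = ev f := fun f => by
    rw [proj_apply, map_smul, map_sum]
    simp_rw [map_smul, heva, smul_smul, D.dual_neg_mul, one_smul, Finset.sum_const,
      Finset.card_univ, ← Nat.cast_smul_eq_nsmul ℂ, smul_smul,
      inv_mul_cancel₀ (card_ne_zero (A := A)), one_smul]
  have hev0 : ∃ f, ev f ≠ 0 := by
    by_contra! h
    have := hirr.nontrivial_space
    obtain ⟨f, hf⟩ := exists_ne (0 : N.toSubmodule)
    apply hf
    ext1
    funext g
    exact (hev g f).symm.trans (h _)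
  obtain ⟨f, hf⟩ := hev0
  have hp0 : D.proj ρ x ≠ 0 := fun h => hf (by rw [← hproj, h, LinearMap.zero_apply, map_zero])
  refine ⟨ρ.character, character_mem_irrChars ρ hirr,
    (D.coeff_character_one_ne_zero ρ).mpr hp0, ?_⟩
  rw [stabCoeff_character]
  refine character_eq_of_intertwining (D.isoRep_isIrreducible ρ hirr hp0) hσ
    (ev.comp (LinearMap.range (D.proj ρ x)).subtype) (fun t v => hevs t v) fun h => hf ?_
  rw [← hproj]
  exact LinearMap.congr_fun h ⟨_, f, rfl⟩

/-- Clifford correspondence, counted: the irreducible characters of `G` are sorted by orbit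
representatives of `H` on the characters of `A`. -/
theorem numIrr_eq_sum (D : DualSplitting G H A X) [Finite G] [Finite H] [Fintype X]
    {I : Type*} [Fintype I] (t : I → X)
    (ht : ∀ x, ∃! i, x ∈ MulAction.orbit H (t i)) (r : ℚ) :
    numIrr G r = ∑ i, numIrr (MulAction.stabilizer H (t i))
      (r / Nat.card (MulAction.orbit H (t i))) := by
  classical
  -- Characters sorted by the orbit over which they lie; a nonzero coefficient at 1 means a nonzero
  -- component.
  let S : I → Set (G → ℂ) := fun i => {χ | χ ∈ irrChars G ∧ χ 1 = (r : ℂ) ∧ D.coeff χ (t i) 1 ≠ 0}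
  have hS : {χ : G → ℂ | χ ∈ irrChars G ∧ χ 1 = (r : ℂ)} = ⋃ i, S i := by
    ext χ
    simp only [Set.mem_ofPred_eq, Set.mem_iUnion, S]
    constructor
    · rintro ⟨h1, h2⟩
      obtain ⟨x, hx⟩ := D.exists_coeff_ne_zero h1
      obtain ⟨i, ⟨h, hi⟩, -⟩ := ht x
      refine ⟨i, h1, h2, ?_⟩
      rwa [← hi, D.coeff_one_smul h1] at hx
    · rintro ⟨i, h1, h2, -⟩
      exact ⟨h1, h2⟩
  have hfin : ∀ i, (S i).Finite := fun i => (irrChars_finite G).subset fun χ h => h.1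
  have hdisj : Pairwise (Disjoint on S) := fun i j hij => by
    rw [Function.onFun, Set.disjoint_left]
    rintro χ ⟨h1, -, h2⟩ ⟨-, -, h3⟩
    exact hij ((ht (t j)).unique (D.mem_orbit_of_coeff_ne_zero h1 h2 h3)
      (MulAction.mem_orbit_self _))
  rw [numIrr, hS, Set.ncard_iUnion_of_finite hfin hdisj, finsum_eq_sum_of_fintype]
  refine Finset.sum_congr rfl fun i _ => ?_
  have hc : (Nat.card (MulAction.orbit H (t i)) : ℂ) ≠ 0 :=
    have := (MulAction.nonempty_orbit (M := H) (t i)).to_subtype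
    Nat.cast_ne_zero.mpr (Nat.card_pos (α := MulAction.orbit H (t i))).ne'
  refine Set.ncard_congr (fun χ _ => D.stabCoeff χ (t i)) ?_ ?_ ?_
  · rintro χ ⟨h1, h2, h3⟩
    refine ⟨D.stabCoeff_mem_irrChars h1 h3, ?_⟩
    rw [D.degree_eq h1 h3] at h2
    push_cast
    rw [← h2, mul_div_cancel_left₀ _ hc]
  · rintro χ χ' ⟨h1, -, h3⟩ ⟨h1', -, -⟩ h
    exact D.eq_of_stabCoeff_eq h1 h1' h3 h
  · rintro ψ ⟨h1, h2⟩
    obtain ⟨χ, hχ, hχ0, rfl⟩ := D.exists_stabCoeff_eq h1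
    refine ⟨χ, ⟨hχ, ?_, hχ0⟩, rfl⟩
    rw [D.degree_eq hχ hχ0, h2]
    push_cast
    rw [mul_div_cancel₀ _ hc]

end DualSplitting

/-! ### Invariance of the counts under isomorphism -/

theorem irrChars_comp_mem {G G' : Type*} [Group G] [Group G'] (e : G ≃* G') {χ : G' → ℂ}
    (hχ : χ ∈ irrChars G') : χ ∘ e ∈ irrChars G := by
  obtain ⟨d, ρ, hρ, rfl⟩ := hχ
  have := hρ.nontrivial_space
  refine ⟨d, ρ.comp e.toMonoidHom, ?_, rfl⟩
  refine Representation.isIrreducible_of_forall _ fun N hN h0 =>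
    hρ.eq_top N (fun g v hv => ?_) h0
  have := hN (e.symm g) v hv
  simpa using this

theorem numIrr_congr {G G' : Type*} [Group G] [Group G'] (e : G ≃* G') (r : ℚ) :
    numIrr G r = numIrr G' r := by
  refine Set.ncard_congr (fun χ _ => χ ∘ e.symm) ?_ ?_ ?_
  · rintro χ ⟨h1, h2⟩
    exact ⟨irrChars_comp_mem e.symm h1, by simpa using h2⟩
  · intro χ χ' _ _ h
    exact e.symm.surjective.injective_comp_right h
  · rintro χ ⟨h1, h2⟩
    exact ⟨χ ∘ e, ⟨irrChars_comp_mem e h1, by simpa using h2⟩, by funext; simp⟩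

/-! ### Matrices in pattern groups -/

section PatternGroup

variable {F : Type*} [Field F] {m : ℕ}

/-- Unit diagonal and zeros off the diagonal outside the pattern `R`. -/
def IsPatternMatrix (R : Fin m → Fin m → Prop) (M : Matrix (Fin m) (Fin m) F) : Prop :=
  (∀ x, M x x = 1) ∧ ∀ x y, x ≠ y → ¬ R x y → M x y = 0

theorem IsPatternMatrix.det_eq_one {R : Fin m → Fin m → Prop} (hlt : ∀ x y, R x y → x < y)
    {M : Matrix (Fin m) (Fin m) F} (hM : IsPatternMatrix R M) : M.det = 1 := by
  rw [Matrix.det_of_isUpperTriangular]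
  · exact Finset.prod_eq_one fun x _ => hM.1 x
  · intro x y hxy
    exact hM.2 x y (ne_of_gt hxy) fun h => lt_asymm hxy (hlt x y h)

variable [Finite F] {R : Fin m → Fin m → Prop} {hlt : ∀ x y, R x y → x < y}
  {htr : ∀ x y z, R x y → R y z → R x z}

/-- The element of a pattern group with a given matrix. -/
noncomputable def patternMk (hlt : ∀ x y, R x y → x < y)
    (htr : ∀ x y z, R x y → R y z → R x z) (M : Matrix (Fin m) (Fin m) F)
    (hM : IsPatternMatrix R M) : patternGroup F m R hlt htr :=
  ⟨Matrix.GeneralLinearGroup.mkOfDetNeZero M (by rw [hM.det_eq_one hlt]; exact one_ne_zero), hM⟩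

theorem patternMk_val (M : Matrix (Fin m) (Fin m) F) (hM : IsPatternMatrix R M) :
    (patternMk hlt htr M hM).1.1 = M := rfl

theorem patternGroup_ext {A B : patternGroup F m R hlt htr} (h : A.1.1 = B.1.1) : A = B :=
  Subtype.ext (Units.ext h)

theorem isPatternMatrix_val (A : patternGroup F m R hlt htr) : IsPatternMatrix R A.1.1 := A.2

theorem patternGroup_val_mul (A B : patternGroup F m R hlt htr) :
    (A * B).1.1 = A.1.1 * B.1.1 := rfl

theorem patternGroup_congr {R R' : Fin m → Fin m → Prop} (hlt : ∀ x y, R x y → x < y)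
    (htr : ∀ x y z, R x y → R y z → R x z) (hlt' : ∀ x y, R' x y → x < y)
    (htr' : ∀ x y z, R' x y → R' y z → R' x z) (h : ∀ x y, R x y ↔ R' x y) :
    patternGroup F m R hlt htr = patternGroup F m R' hlt' htr' := by
  obtain rfl : R = R' := funext fun x => funext fun y => propext (h x y)
  rfl

end PatternGroup

/-! ### The first row as an abelian normal subgroup, and its dual -/

section FirstRow

variable {F : Type*} [Field F] {m : ℕ}

/-- The block matrix with first row `(1, w)`, lower right block `M` and zeros below the first
diagonal entry. -/
def rowBlock (w : Fin m → F) (M : Matrix (Fin m) (Fin m) F) :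
    Matrix (Fin (m + 1)) (Fin (m + 1)) F :=
  Matrix.of (Fin.cons (Fin.cons 1 w) fun i => Fin.cons 0 (M i))

@[simp] theorem rowBlock_zero_zero (w : Fin m → F) (M : Matrix (Fin m) (Fin m) F) :
    rowBlock w M 0 0 = 1 := rfl

@[simp] theorem rowBlock_zero_succ (w : Fin m → F) (M : Matrix (Fin m) (Fin m) F) (j : Fin m) :
    rowBlock w M 0 j.succ = w j := rfl

@[simp] theorem rowBlock_succ_zero (w : Fin m → F) (M : Matrix (Fin m) (Fin m) F) (i : Fin m) :
    rowBlock w M i.succ 0 = 0 := rfl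

@[simp] theorem rowBlock_succ_succ (w : Fin m → F) (M : Matrix (Fin m) (Fin m) F)
    (i j : Fin m) : rowBlock w M i.succ j.succ = M i j := rfl

/-- This multiplication rule contains the whole semidirect structure: blocks with `M = 1` add,
blocks with `w = 0` multiply. -/
theorem rowBlock_mul (w w' : Fin m → F) (M M' : Matrix (Fin m) (Fin m) F) :
    rowBlock w M * rowBlock w' M' = rowBlock (w' + Matrix.vecMul w M') (M * M') := by
  ext x y
  rw [Matrix.mul_apply, Fin.sum_univ_succ]
  refine Fin.cases ?_ (fun i => ?_) x <;> refine Fin.cases ?_ (fun j => ?_) y <;>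
    simp [Matrix.vecMul, dotProduct, Matrix.mul_apply]

theorem rowBlock_zero_one : rowBlock (0 : Fin m → F) 1 = 1 := by
  ext x y
  refine Fin.cases ?_ (fun i => ?_) x <;> refine Fin.cases ?_ (fun j => ?_) y <;>
    simp [Matrix.one_apply, Fin.succ_ne_zero, (Fin.succ_ne_zero _).symm]

theorem rowBlock_injective {w w' : Fin m → F} {M M' : Matrix (Fin m) (Fin m) F}
    (h : rowBlock w M = rowBlock w' M') : w = w' ∧ M = M' := by
  constructor
  · funext j
    exact congrFun (congrFun h 0) j.succ
  · ext i j
    exact congrFun (congrFun h i.succ) j.succ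

variable (R : Fin (m + 1) → Fin (m + 1) → Prop)

/-- The positions of the first row that belong to the pattern. -/
abbrev FirstRow := {j : Fin m // R 0 j.succ}

/-- The pattern left when the first row and the first column are deleted. -/
abbrev tailPattern (x y : Fin m) : Prop := R x.succ y.succ

variable {R}

open Classical in
/-- Extension by zero of a vector indexed by the first row of a pattern. -/
noncomputable def extendRow (v : FirstRow R → F) (j : Fin m) : F :=
  if h : R 0 j.succ then v ⟨j, h⟩ else 0

theorem extendRow_coe (v : FirstRow R → F) (j : FirstRow R) : extendRow v j = v j :=
  dif_pos j.2

theorem extendRow_of_not (v : FirstRow R → F) {j : Fin m} (h : ¬ R 0 j.succ) :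
    extendRow v j = 0 := dif_neg h

theorem extendRow_add (v w : FirstRow R → F) :
    extendRow (v + w) = extendRow v + extendRow w := by
  funext j
  by_cases h : R 0 j.succ
  · simp [extendRow, h]
  · simp [extendRow, h]

theorem sum_extendRow_mul (v : FirstRow R → F) (u : Fin m → F) [Fintype (FirstRow R)] :
    ∑ j, extendRow v j * u j = ∑ j : FirstRow R, v j * u j := by
  symm
  refine Fintype.sum_of_injective Subtype.val Subtype.val_injective _ _ (fun j hj => ?_)
    fun j => by rw [extendRow_coe]
  rw [extendRow_of_not, zero_mul]
  exact fun h => hj ⟨⟨j, h⟩, rfl⟩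

variable [Finite F] {hlt : ∀ x y, R x y → x < y} {htr : ∀ x y z, R x y → R y z → R x z}

theorem tail_lt (hlt : ∀ x y, R x y → x < y) (x y : Fin m) (h : tailPattern R x y) : x < y :=
  Fin.succ_lt_succ_iff.mp (hlt _ _ h)

theorem tail_trans (htr : ∀ x y z, R x y → R y z → R x z) (x y z : Fin m)
    (h : tailPattern R x y) (h' : tailPattern R y z) : tailPattern R x z := htr _ _ _ h h'

variable (F) in
/-- The pattern group of the pattern without its first row and column. -/
abbrev TailGroup (hlt : ∀ x y, R x y → x < y) (htr : ∀ x y z, R x y → R y z → R x z) :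
    Subgroup (GL (Fin m) F) :=
  patternGroup F m (tailPattern R) (tail_lt hlt) (tail_trans htr)

/-- The positions of the first row are closed under the pattern. -/
theorem tail_entry_eq_zero (h : TailGroup F hlt htr) {j k : Fin m} (hj : R 0 j.succ)
    (hk : ¬ R 0 k.succ) : h.1.1 j k = 0 :=
  h.2.2 j k (fun e => hk (e ▸ hj)) fun hR => hk (htr _ _ _ hj hR)

theorem vecMul_extendRow_of_not (h : TailGroup F hlt htr) (v : FirstRow R → F) {k : Fin m}
    (hk : ¬ R 0 k.succ) : Matrix.vecMul (extendRow v) h.1.1 k = 0 := by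
  change ∑ j, extendRow v j * h.1.1 j k = 0
  refine Finset.sum_eq_zero fun j _ => ?_
  by_cases hj : R 0 j.succ
  · rw [tail_entry_eq_zero h hj hk, mul_zero]
  · rw [extendRow_of_not v hj, zero_mul]

theorem extendRow_vecMul (h : TailGroup F hlt htr) (v : FirstRow R → F) :
    extendRow (R := R) (fun j => Matrix.vecMul (extendRow v) h.1.1 j) =
      Matrix.vecMul (extendRow v) h.1.1 := by
  funext k
  by_cases hk : R 0 k.succ
  · exact extendRow_coe _ ⟨k, hk⟩
  · rw [extendRow_of_not _ hk, vecMul_extendRow_of_not h v hk]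

/-- Transitivity of the pattern leaves no entry of `h` from a first-row position to a position
outside, so coordinates outside do not influence those inside. -/
theorem mulVec_extendRow (h : TailGroup F hlt htr) (u : Fin m → F) (j : FirstRow R) :
    h.1.1.mulVec (extendRow fun k : FirstRow R => u k) j = h.1.1.mulVec u j := by
  change ∑ k, h.1.1 j k * extendRow (fun k : FirstRow R => u k) k = ∑ k, h.1.1 j k * u k
  refine Finset.sum_congr rfl fun k _ => ?_
  by_cases hk : R 0 k.succ
  · rw [extendRow_coe _ (⟨k, hk⟩ : FirstRow R)]
  · rw [tail_entry_eq_zero h j.2 hk, zero_mul, zero_mul]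

variable (F) in
/-- Vectors indexed by the first row, thought of as characters of the group of the first row. -/
def RowDual (_hlt : ∀ x y, R x y → x < y) (_htr : ∀ x y z, R x y → R y z → R x z) : Type _ :=
  FirstRow R → F

/-- Left multiplication on columns modulo those supported outside the first row; `mulVec_extendRow`
makes this an action. -/
noncomputable instance : MulAction (TailGroup F hlt htr) (RowDual F hlt htr) where
  smul h c := fun j => h.1.1.mulVec (extendRow c) j
  one_smul c := by
    funext j
    exact (congrFun (Matrix.one_mulVec _) _).trans (extendRow_coe _ _)
  mul_smul g h c := by
    funext j
    change (g.1.1 * h.1.1).mulVec (extendRow c) j = g.1.1.mulVec (extendRow _) j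
    rw [← Matrix.mulVec_mulVec]
    exact (mulVec_extendRow g _ j).symm

omit [Finite F] in
theorem sum_mul_eq_dotProduct [Fintype (FirstRow R)] (w : FirstRow R → F) (u : Fin m → F) :
    ∑ j : FirstRow R, w j * u j = extendRow w ⬝ᵥ u := (sum_extendRow_mul w u).symm

/-- The pairing is invariant because `(v h⁻¹)(h c) = v c`; this is the equivariance of the
parametrization of characters by columns. -/
theorem dotProduct_conj [Fintype (FirstRow R)] (h : TailGroup F hlt htr) (c : FirstRow R → F)
    (v : FirstRow R → F) :
    ∑ j : FirstRow R, Matrix.vecMul (extendRow v) h⁻¹.1.1 j * h.1.1.mulVec (extendRow c) j =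
      ∑ j : FirstRow R, v j * c j := by
  have h3 : h⁻¹.1.1 * h.1.1 = 1 := by
    rw [← patternGroup_val_mul, inv_mul_cancel]
    rfl
  have h4 : ∑ j : FirstRow R, v j * c j = ∑ j : FirstRow R, v j * extendRow c j :=
    Finset.sum_congr rfl fun j _ => by rw [extendRow_coe]
  rw [h4, sum_mul_eq_dotProduct, sum_mul_eq_dotProduct,
    extendRow_vecMul, Matrix.dotProduct_mulVec, Matrix.vecMul_vecMul, h3, Matrix.vecMul_one]

omit [Finite F] in
theorem isPatternMatrix_rowBlock (v : FirstRow R → F)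
    {M : Matrix (Fin m) (Fin m) F} (hM : IsPatternMatrix (tailPattern R) M) :
    IsPatternMatrix R (rowBlock (extendRow v) M) := by
  constructor
  · exact Fin.cases rfl fun i => hM.1 i
  · refine Fin.cases (Fin.cases (fun h => absurd rfl h) fun j _ hj => extendRow_of_not v hj)
      fun i => Fin.cases (fun _ _ => rfl) fun j hij hR => ?_
    exact hM.2 i j (fun e => hij (congrArg _ e)) hR

omit [Finite F] in
theorem isPatternMatrix_one (m : ℕ) (R : Fin m → Fin m → Prop) :
    IsPatternMatrix R (1 : Matrix (Fin m) (Fin m) F) :=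
  ⟨fun x => Matrix.one_apply_eq x, fun _ _ h _ => Matrix.one_apply_ne h⟩

omit [Finite F] in
theorem extendRow_zero : extendRow (0 : FirstRow R → F) = 0 := by
  funext j
  by_cases h : R 0 j.succ
  · exact extendRow_coe _ (⟨j, h⟩ : FirstRow R)
  · exact extendRow_of_not _ h

omit [Finite F] in
theorem extendRow_injective : Injective (extendRow : (FirstRow R → F) → Fin m → F) :=
  fun v w h => by
    funext j
    rw [← extendRow_coe v, h, extendRow_coe]

theorem exists_eq_rowBlock (A : patternGroup F (m + 1) R hlt htr) :
    ∃ (v : FirstRow R → F) (M : Matrix (Fin m) (Fin m) F),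
      IsPatternMatrix (tailPattern R) M ∧ A.1.1 = rowBlock (extendRow v) M := by
  refine ⟨fun j => A.1.1 0 j.1.succ, fun i j => A.1.1 i.succ j.succ, ⟨fun i => A.2.1 _,
    fun i j hij hR => A.2.2 _ _ (fun e => hij (Fin.succ_injective _ e)) hR⟩, ?_⟩
  ext x y
  refine Fin.cases (Fin.cases ?_ fun j => ?_) (fun i => Fin.cases ?_ fun j => ?_) x y
  · exact A.2.1 0
  · change A.1.1 0 j.succ = extendRow (fun j : FirstRow R => A.1.1 0 j.1.succ) j
    by_cases hj : R 0 j.succ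
    · exact (extendRow_coe (fun j : FirstRow R => A.1.1 0 j.1.succ) ⟨j, hj⟩).symm
    · rw [extendRow_of_not _ hj]
      exact A.2.2 _ _ (Fin.succ_ne_zero j).symm hj
  · exact A.2.2 _ _ (Fin.succ_ne_zero i) fun h => absurd (hlt _ _ h) (Fin.not_lt_zero _)
  · rfl

/-- The additive character of row vectors given by a column vector. -/
noncomputable def rowChar [Fintype (FirstRow R)] (ψ : AddChar F ℂ) (c : FirstRow R → F) :
    AddChar (FirstRow R → F) ℂ where
  toFun v := ψ (∑ j, v j * c j)
  map_zero_eq_one' := by simp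
  map_add_eq_mul' v w := by
    simp [add_mul, Finset.sum_add_distrib, AddChar.map_add_eq_mul]

theorem exists_addChar_ne_one (F : Type*) [Field F] [Finite F] :
    ∃ ψ : AddChar F ℂ, ∀ a : F, a ≠ 0 → ∃ b, ψ (b * a) ≠ 1 := by
  obtain ⟨ψ, hψ⟩ := AddChar.exists_apply_ne_zero.mpr (one_ne_zero (α := F))
  exact ⟨ψ, fun a ha => ⟨a⁻¹, by rwa [inv_mul_cancel₀ ha]⟩⟩

/-- Testing on multiples of coordinate vectors gives injectivity; a finite abelian group and its
dual have the same order. -/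
theorem rowChar_bijective [Fintype (FirstRow R)] {ψ : AddChar F ℂ}
    (hψ : ∀ a : F, a ≠ 0 → ∃ b, ψ (b * a) ≠ 1) :
    Bijective (rowChar ψ : (FirstRow R → F) → AddChar (FirstRow R → F) ℂ) := by
  classical
  have := Fintype.ofFinite F
  rw [Fintype.bijective_iff_injective_and_card]
  refine ⟨fun c c' h => ?_, AddChar.card_eq.symm⟩
  funext j
  by_contra hne
  obtain ⟨b, hb⟩ := hψ _ (sub_ne_zero.mpr hne)
  apply hb
  have h1 := DFunLike.congr_fun h (Pi.single j b)
  change ψ (∑ k, (Pi.single j b : FirstRow R → F) k * c k) =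
    ψ (∑ k, (Pi.single j b : FirstRow R → F) k * c' k) at h1
  simp only [Pi.single_apply, ite_mul, zero_mul, Finset.sum_ite_eq', Finset.mem_univ,
    if_true] at h1
  rw [mul_sub, AddChar.map_sub_eq_div, h1, div_self]
  exact (AddChar.val_isUnit ψ _).ne_zero

/-- Splitting off the first row of a pattern group. -/
noncomputable def firstRowSplitting [Fintype (FirstRow R)] (hlt : ∀ x y, R x y → x < y)
    (htr : ∀ x y z, R x y → R y z → R x z) (ψ : AddChar F ℂ)
    (hψ : ∀ a : F, a ≠ 0 → ∃ b, ψ (b * a) ≠ 1) :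
    DualSplitting (patternGroup F (m + 1) R hlt htr) (TailGroup F hlt htr) (FirstRow R → F)
      (RowDual F hlt htr) where
  incl v := patternMk hlt htr (rowBlock (extendRow v) 1)
    (isPatternMatrix_rowBlock v (isPatternMatrix_one _ _))
  incl_add v w := by
    apply patternGroup_ext
    rw [patternGroup_val_mul, patternMk_val, patternMk_val, patternMk_val, rowBlock_mul,
      Matrix.vecMul_one, mul_one, extendRow_add, add_comm (extendRow v)]
  sec :=
    { toFun := fun h => patternMk hlt htr (rowBlock (extendRow 0) h.1.1)
        (isPatternMatrix_rowBlock 0 (isPatternMatrix_val h))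
      map_one' := by
        apply patternGroup_ext
        rw [patternMk_val, extendRow_zero]
        exact rowBlock_zero_one
      map_mul' := fun g h => by
        apply patternGroup_ext
        change rowBlock _ (g.1.1 * h.1.1) = rowBlock _ _ * rowBlock _ _
        rw [rowBlock_mul, extendRow_zero, Matrix.zero_vecMul, add_zero] }
  bijective_mul := by
    constructor
    · rintro ⟨h, v⟩ ⟨h', v'⟩ he
      have h1 := congrArg (fun A => A.1.1) he
      change rowBlock _ _ * rowBlock _ _ = rowBlock _ _ * rowBlock _ _ at h1
      rw [rowBlock_mul, rowBlock_mul] at h1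
      obtain ⟨h2, h3⟩ := rowBlock_injective h1
      rw [Matrix.vecMul_one] at h2
      rw [mul_one, mul_one] at h3
      exact Prod.ext (patternGroup_ext h3) (extendRow_injective (add_right_cancel h2))
    · intro A
      obtain ⟨v, M, hM, hA⟩ := exists_eq_rowBlock A
      refine ⟨(patternMk _ _ M hM, v), patternGroup_ext ?_⟩
      change rowBlock _ _ * rowBlock _ _ = _
      rw [rowBlock_mul, hA, Matrix.vecMul_one, mul_one, extendRow_zero, add_zero]
      rfl
  -- Both products in `sec_mul_incl` are the block matrix with row `v` and block `h`, which forces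
  -- the row `v h⁻¹`.
  conj h v := fun j => Matrix.vecMul (extendRow v) h⁻¹.1.1 j
  sec_mul_incl h v := by
    apply patternGroup_ext
    change rowBlock _ _ * rowBlock _ _ = rowBlock _ _ * rowBlock _ _
    have h3 : h⁻¹.1.1 * h.1.1 = 1 := by
      rw [← patternGroup_val_mul, inv_mul_cancel]
      rfl
    rw [rowBlock_mul, rowBlock_mul, extendRow_vecMul, Matrix.vecMul_vecMul, h3, Matrix.vecMul_one,
      extendRow_zero, Matrix.vecMul_one, zero_add, add_zero, mul_one, one_mul]
  dual := rowChar ψ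
  dual_bijective := rowChar_bijective hψ
  dual_smul h c v := congrArg ψ (dotProduct_conj h c v)

end FirstRow

/-! ### Orbits and stabilizers on the dual of the first row -/

section FirstRowOrbits

variable {F : Type*} [Field F] [Finite F] {m : ℕ} {R : Fin (m + 1) → Fin (m + 1) → Prop}
  {hlt : ∀ x y, R x y → x < y} {htr : ∀ x y z, R x y → R y z → R x z}

variable (F) in
/-- The zero column vector. -/
def rowDualZero (hlt : ∀ x y, R x y → x < y) (htr : ∀ x y z, R x y → R y z → R x z) :
    RowDual F hlt htr := (0 : FirstRow R → F)

theorem smul_rowDualZero (h : TailGroup F hlt htr) :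
    h • rowDualZero F hlt htr = rowDualZero F hlt htr := by
  funext j
  change h.1.1.mulVec (extendRow (0 : FirstRow R → F)) j = 0
  rw [extendRow_zero, Matrix.mulVec_zero]
  rfl

open Classical in
/-- The column vector whose only nonzero entry is `c`, at position `j`. -/
noncomputable def rowDualSingle (hlt : ∀ x y, R x y → x < y)
    (htr : ∀ x y z, R x y → R y z → R x z) (j : FirstRow R) (c : F) : RowDual F hlt htr :=
  (Pi.single j c : FirstRow R → F)

omit [Finite F] in
theorem rowDualSingle_self (j : FirstRow R) (c : F) : rowDualSingle hlt htr j c j = c := by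
  simp [rowDualSingle]

omit [Finite F] in
theorem rowDualSingle_of_ne {j k : FirstRow R} (h : k ≠ j) (c : F) :
    rowDualSingle hlt htr j c k = 0 := by
  simp [rowDualSingle, h]

theorem smul_rowDualSingle (h : TailGroup F hlt htr) (j : FirstRow R) (c : F) (k : FirstRow R) :
    (h • rowDualSingle hlt htr j c) k = h.1.1 k j * c := by
  change ∑ l, h.1.1 k l * extendRow (rowDualSingle hlt htr j c : FirstRow R → F) l = _
  rw [Finset.sum_eq_single j.1]
  · congr 1
    exact (extendRow_coe _ j).trans (rowDualSingle_self j c)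
  · intro l _ hl
    by_cases hR : R 0 l.succ
    · have : extendRow (rowDualSingle hlt htr j c : FirstRow R → F) l = 0 :=
        (extendRow_coe _ (⟨l, hR⟩ : FirstRow R)).trans
          (rowDualSingle_of_ne (fun e => hl (congrArg Subtype.val e)) c)
      rw [this, mul_zero]
    · have : extendRow (rowDualSingle hlt htr j c : FirstRow R → F) l = 0 :=
        extendRow_of_not _ hR
      rw [this, mul_zero]
  · exact fun h => absurd (Finset.mem_univ _) h

theorem tailGroup_entry_of_lt (h : TailGroup F hlt htr) {x y : Fin m} (hxy : y < x) :
    h.1.1 x y = 0 :=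
  h.2.2 x y hxy.ne' fun hR => lt_asymm hxy (tail_lt hlt _ _ hR)

/-- The image of `c e_j` under `h` is `c` times column `j` of `h`: zero below `j`, equal to `c` at
`j`, and arbitrary above, since `hfull` puts all positions above `j` in first-row rows into the
pattern. -/
theorem mem_orbit_rowDualSingle
    (hfull : ∀ x y : Fin m, R 0 x.succ → R 0 y.succ → x < y → R x.succ y.succ)
    {j : FirstRow R} {c : F} (hc : c ≠ 0) {u : RowDual F hlt htr} :
    u ∈ MulAction.orbit (TailGroup F hlt htr) (rowDualSingle hlt htr j c) ↔
      u j = c ∧ ∀ k, j < k → u k = 0 := by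
  classical
  constructor
  · rintro ⟨h, rfl⟩
    refine ⟨?_, fun k hk => ?_⟩
    · change (h • rowDualSingle hlt htr j c) j = c
      rw [smul_rowDualSingle, h.2.1, one_mul]
    · change (h • rowDualSingle hlt htr j c) k = 0
      rw [smul_rowDualSingle, tailGroup_entry_of_lt h (x := k) (y := j) hk, zero_mul]
  · rintro ⟨hj, hk⟩
    -- The identity with the part of column `j` above the diagonal replaced by `u / c`.
    let M : Matrix (Fin m) (Fin m) F := Matrix.of fun x y =>
      if x = y then 1 else if y = j ∧ x < j then extendRow (u : FirstRow R → F) x / c else 0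
    have hM : IsPatternMatrix (tailPattern R) M := by
      refine ⟨fun x => if_pos rfl, fun x y hxy hR => ?_⟩
      simp only [M, Matrix.of_apply, if_neg hxy]
      split_ifs with h
      · by_cases hx : R 0 x.succ
        · exact absurd (hfull x y hx (h.1 ▸ j.2) (h.1 ▸ h.2)) hR
        · have : extendRow (u : FirstRow R → F) x = 0 := extendRow_of_not _ hx
          rw [this, zero_div]
      · rfl
    refine ⟨patternMk _ _ M hM, ?_⟩
    funext k
    change (_ • rowDualSingle hlt htr j c) k = _
    rw [smul_rowDualSingle, patternMk_val]
    simp only [M, Matrix.of_apply, true_and]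
    rcases lt_trichotomy k j with h | rfl | h
    · have h1 : (k : Fin m) < j := h
      rw [if_neg h1.ne, if_pos h1, div_mul_cancel₀ _ hc]
      exact extendRow_coe _ k
    · rw [if_pos rfl, one_mul, hj]
    · have h1 : (j : Fin m) < k := h
      rw [if_neg h1.ne', if_neg h1.not_gt, zero_mul, hk k h]

theorem card_orbit_rowDualSingle
    (hfull : ∀ x y : Fin m, R 0 x.succ → R 0 y.succ → x < y → R x.succ y.succ)
    {j : FirstRow R} {c : F} (hc : c ≠ 0) :
    Nat.card (MulAction.orbit (TailGroup F hlt htr) (rowDualSingle hlt htr j c)) =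
      Nat.card F ^ Nat.card {x : FirstRow R // x < j} := by
  classical
  rw [← Nat.card_fun]
  refine Nat.card_eq_of_bijective
    (fun u (x : {x : FirstRow R // x < j}) => (u.1 : FirstRow R → F) x) ⟨?_, ?_⟩
  · rintro ⟨u, hu⟩ ⟨v, hv⟩ h
    rw [mem_orbit_rowDualSingle hfull hc] at hu hv
    refine Subtype.ext (funext fun k => ?_)
    rcases lt_trichotomy k j with hk | rfl | hk
    · exact congrFun h ⟨k, hk⟩
    · exact hu.1.trans hv.1.symm
    · exact (hu.2 k hk).trans (hv.2 k hk).symm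
  · intro w
    refine ⟨⟨fun k => if hk : k < j then w ⟨k, hk⟩ else if k = j then c else 0,
      (mem_orbit_rowDualSingle hfull hc).mpr ⟨?_, fun k hk => ?_⟩⟩, ?_⟩
    · rw [dif_neg (lt_irrefl j), if_pos rfl]
    · rw [dif_neg hk.not_gt, if_neg hk.ne']
    · funext x
      exact dif_pos x.2

/-- The tail pattern, with those positions of column `j` removed whose row belongs to the first
row of the pattern. -/
abbrev columnPattern (R : Fin (m + 1) → Fin (m + 1) → Prop) (j x y : Fin m) : Prop :=
  R x.succ y.succ ∧ (y = j → ¬ R 0 x.succ)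

theorem columnPattern_lt (hlt : ∀ x y, R x y → x < y) (j x y : Fin m)
    (h : columnPattern R j x y) : x < y := tail_lt hlt x y h.1

theorem columnPattern_trans (htr : ∀ x y z, R x y → R y z → R x z) (j x y z : Fin m)
    (h : columnPattern R j x y) (h' : columnPattern R j y z) : columnPattern R j x z :=
  ⟨htr _ _ _ h.1 h'.1, fun e hx => h'.2 e (htr _ _ _ hx h.1)⟩

/-- Fixing `c e_j` constrains column `j` only in rows that occur in the first row. Entries of that
column in other rows stay free, which is how the groups `Q` arise. -/
theorem map_stabilizer_rowDualSingle (j : FirstRow R) {c : F} (hc : c ≠ 0) :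
    (MulAction.stabilizer (TailGroup F hlt htr) (rowDualSingle hlt htr j c)).map
      (TailGroup F hlt htr).subtype =
      patternGroup F m (columnPattern R j) (columnPattern_lt hlt j) (columnPattern_trans htr j) := by
  ext A
  constructor
  · rintro ⟨h, hh, rfl⟩
    refine ⟨h.2.1, fun x y hxy hR => ?_⟩
    by_cases hR' : R x.succ y.succ
    · have h1 : y = j ∧ R 0 x.succ := by
        by_contra hn
        exact hR ⟨hR', fun e hx => hn ⟨e, hx⟩⟩
      have h2 : h • rowDualSingle hlt htr j c = rowDualSingle hlt htr j c := hh
      have h3 : h.1.1 x j * c = 0 := by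
        rw [← smul_rowDualSingle h j c ⟨x, h1.2⟩, h2]
        exact rowDualSingle_of_ne (fun e => hxy ((congrArg Subtype.val e).trans h1.1.symm)) c
      rw [h1.1]
      exact (mul_eq_zero.mp h3).resolve_right hc
    · exact h.2.2 x y hxy hR'
  · intro hA
    refine ⟨⟨A, hA.1, fun x y hxy hR => hA.2 x y hxy fun h => hR h.1⟩, ?_, rfl⟩
    rw [SetLike.mem_coe, MulAction.mem_stabilizer_iff]
    funext k
    rw [smul_rowDualSingle]
    by_cases hk : k = j
    · subst hk
      rw [rowDualSingle_self]
      exact (congrArg (· * c) (hA.1 _)).trans (one_mul c)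
    · rw [rowDualSingle_of_ne hk]
      have : A.1 k j = 0 := hA.2 k j (fun e => hk (Subtype.ext e)) fun h => h.2 rfl k.2
      exact (congrArg (· * c) this).trans (zero_mul c)

theorem numIrr_stabilizer_rowDualSingle (j : FirstRow R) {c : F} (hc : c ≠ 0) (r : ℚ) :
    numIrr (MulAction.stabilizer (TailGroup F hlt htr) (rowDualSingle hlt htr j c)) r =
      numIrr (patternGroup F m (columnPattern R j) (columnPattern_lt hlt j)
        (columnPattern_trans htr j)) r := by
  rw [← map_stabilizer_rowDualSingle j hc]
  exact numIrr_congr (Subgroup.equivMapOfInjective _ _ (Subgroup.subtype_injective _)) r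

variable (F) in
/-- Representatives of the orbits on the characters of the first row. -/
noncomputable def orbitRep (hlt : ∀ x y, R x y → x < y) (htr : ∀ x y z, R x y → R y z → R x z) :
    Option (FirstRow R × Fˣ) → RowDual F hlt htr
  | none => rowDualZero F hlt htr
  | some p => rowDualSingle hlt htr p.1 p.2

theorem orbit_zero_rowDual :
    MulAction.orbit (TailGroup F hlt htr) (orbitRep F hlt htr none) = {orbitRep F hlt htr none} := by
  ext u
  constructor
  · rintro ⟨h, rfl⟩
    exact smul_rowDualZero h
  · rintro rfl
    exact MulAction.mem_orbit_self _

theorem existsUnique_mem_orbit_orbitRep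
    (hfull : ∀ x y : Fin m, R 0 x.succ → R 0 y.succ → x < y → R x.succ y.succ)
    (u : RowDual F hlt htr) :
    ∃! i, u ∈ MulAction.orbit (TailGroup F hlt htr) (orbitRep F hlt htr i) := by
  classical
  by_cases hu : u = rowDualZero F hlt htr
  · refine ⟨none, ?_, ?_⟩
    · subst hu
      exact MulAction.mem_orbit_self _
    · rintro (_ | ⟨j, c⟩) h
      · rfl
      · have := ((mem_orbit_rowDualSingle hfull c.ne_zero).mp h).1
        rw [hu] at this
        exact absurd this.symm c.ne_zero
  · have hne : ∃ j, u j ≠ 0 := by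
      by_contra! h
      exact hu (funext h)
    -- The representative is read off from the last nonzero coordinate of `u`: its position and its
    -- value.
    obtain ⟨j, hj, hmax⟩ := Set.Finite.exists_maximal (s := {j : FirstRow R | u j ≠ 0})
      (Set.toFinite _) hne
    have hmax' : ∀ k, j < k → u k = 0 := fun k hk => by
      by_contra h
      exact hk.not_ge (hmax h hk.le)
    refine ⟨some (j, Units.mk0 _ hj), ?_, ?_⟩
    · exact (mem_orbit_rowDualSingle hfull (Units.ne_zero _)).mpr ⟨rfl, hmax'⟩
    · rintro (_ | ⟨k, c⟩) h
      · rw [orbit_zero_rowDual] at h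
        exact absurd h hu
      · obtain ⟨h1, h2⟩ := (mem_orbit_rowDualSingle hfull c.ne_zero).mp h
        have hjk : k = j := by
          rcases lt_trichotomy k j with hk | hk | hk
          · exact absurd (h2 j hk) hj
          · exact hk
          · exact absurd (h1.symm.trans (hmax' k hk)) c.ne_zero
        subst hjk
        rw [Option.some_inj, Prod.mk.injEq]
        exact ⟨rfl, Units.ext h1.symm⟩

/-- Removal of the first row: the characters of a pattern group in terms of those of smaller
pattern groups. -/
theorem numIrr_patternGroup_succ [Fintype (FirstRow R)] (hlt : ∀ x y, R x y → x < y)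
    (htr : ∀ x y z, R x y → R y z → R x z)
    (hfull : ∀ x y : Fin m, R 0 x.succ → R 0 y.succ → x < y → R x.succ y.succ) (r : ℚ) :
    numIrr (patternGroup F (m + 1) R hlt htr) r =
      numIrr (TailGroup F hlt htr) r + (Nat.card F - 1) * ∑ j : FirstRow R,
        numIrr (patternGroup F m (columnPattern R j) (columnPattern_lt hlt j)
          (columnPattern_trans htr j))
          (r / (Nat.card F : ℚ) ^ Nat.card {x : FirstRow R // x < j}) := by
  classical
  have := Fintype.ofFinite F
  let _ : Fintype (RowDual F hlt htr) := inferInstanceAs (Fintype (FirstRow R → F))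
  obtain ⟨ψ, hψ⟩ := exists_addChar_ne_one F
  rw [(firstRowSplitting hlt htr ψ hψ).numIrr_eq_sum (orbitRep F hlt htr)
    (existsUnique_mem_orbit_orbitRep hfull), Fintype.sum_option]
  congr 1
  · rw [orbit_zero_rowDual, Nat.card_unique, Nat.cast_one, div_one]
    have htop : MulAction.stabilizer (TailGroup F hlt htr) (orbitRep F hlt htr none) = ⊤ := by
      rw [eq_top_iff]
      exact fun h _ => smul_rowDualZero h
    rw [htop]
    exact numIrr_congr Subgroup.topEquiv r
  · rw [Fintype.sum_prod_type, Finset.mul_sum]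
    refine Finset.sum_congr rfl fun j _ => ?_
    -- Neither the stabilizer nor the orbit length depends on `c`, so the sum over units is
    -- multiplication by `q - 1`.
    have hterm : ∀ c : Fˣ, numIrr (MulAction.stabilizer (TailGroup F hlt htr)
        (rowDualSingle hlt htr j (c : F))) (r / (Nat.card
          (MulAction.orbit (TailGroup F hlt htr) (rowDualSingle hlt htr j (c : F))) : ℚ)) =
        numIrr (patternGroup F m (columnPattern R j) (columnPattern_lt hlt j)
          (columnPattern_trans htr j))
          (r / (Nat.card F : ℚ) ^ Nat.card {x : FirstRow R // x < j}) := fun c => by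
      rw [numIrr_stabilizer_rowDualSingle j c.ne_zero, card_orbit_rowDualSingle hfull c.ne_zero,
        Nat.cast_pow]
    rw [Nat.card_eq_fintype_card (α := F), ← Fintype.card_units, ← Finset.card_univ,
      ← smul_eq_mul, ← Finset.sum_const]
    refine Finset.sum_congr rfl fun c _ => ?_
    rw [← Nat.card_eq_fintype_card (α := F)]
    exact hterm c

end FirstRowOrbits

/-- The correspondence for the trivial action: orbits are points, stabilizers are all of `H`, and
`A` has as many characters as elements. -/
theorem numIrr_prod_multiplicative (H A : Type*) [Group H] [Finite H] [AddCommGroup A] [Finite A]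
    (r : ℚ) : numIrr (H × Multiplicative A) r = Nat.card A * numIrr H r := by
  classical
  have := Fintype.ofFinite A
  let act : MulAction H (AddChar A ℂ) :=
    { smul := fun _ x => x
      one_smul := fun _ => rfl
      mul_smul := fun _ _ _ => rfl }
  have hsmul : ∀ (h : H) (x : AddChar A ℂ), h • x = x := fun _ _ => rfl
  let D : DualSplitting (H × Multiplicative A) H A (AddChar A ℂ) :=
    { incl := fun a => (1, Multiplicative.ofAdd a)
      incl_add := fun a b => by simp
      sec := MonoidHom.inl H (Multiplicative A)
      bijective_mul := by
        constructor
        · rintro ⟨h, a⟩ ⟨h', a'⟩ he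
          simpa using he
        · rintro ⟨h, a⟩
          exact ⟨(h, a.toAdd), by simp⟩
      conj := fun _ a => a
      sec_mul_incl := fun h a => by simp
      dual := id
      dual_bijective := bijective_id
      dual_smul := fun _ _ _ => rfl }
  have horb : ∀ x : AddChar A ℂ, MulAction.orbit H x = {x} := fun x => by
    ext y
    exact ⟨fun ⟨h, hy⟩ => hy.symm, fun hy => ⟨1, hy.symm⟩⟩
  have hstab : ∀ x : AddChar A ℂ, MulAction.stabilizer H x = ⊤ := fun x => by
    rw [eq_top_iff]
    exact fun h _ => hsmul h x
  rw [D.numIrr_eq_sum id (fun x => ⟨x, MulAction.mem_orbit_self _, fun y hy => by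
    exact ((Set.ext_iff.mp (horb y) x).mp hy).symm⟩)]
  have hterm : ∀ x : AddChar A ℂ, numIrr (MulAction.stabilizer H (id x))
      (r / (Nat.card (MulAction.orbit H (id x)) : ℚ)) = numIrr H r := fun x => by
    rw [id, horb, Nat.card_unique, Nat.cast_one, div_one, hstab]
    exact numIrr_congr Subgroup.topEquiv r
  rw [Finset.sum_congr rfl fun x _ => hterm x, Finset.sum_const, Finset.card_univ, smul_eq_mul,
    AddChar.card_eq, Nat.card_eq_fintype_card]

/-! ### Removing a trivial or nearly trivial last column -/

section LastColumn

variable {F : Type*} [Field F] [Finite F] {m : ℕ} {R : Fin (m + 1) → Fin (m + 1) → Prop}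
  {hlt : ∀ x y, R x y → x < y} {htr : ∀ x y z, R x y → R y z → R x z}

/-- The pattern left when the last row and the last column are deleted. -/
abbrev initPattern (R : Fin (m + 1) → Fin (m + 1) → Prop) (x y : Fin m) : Prop :=
  R x.castSucc y.castSucc

theorem init_lt (hlt : ∀ x y, R x y → x < y) (x y : Fin m) (h : initPattern R x y) : x < y :=
  Fin.castSucc_lt_castSucc_iff.mp (hlt _ _ h)

theorem init_trans (htr : ∀ x y z, R x y → R y z → R x z) (x y z : Fin m)
    (h : initPattern R x y) (h' : initPattern R y z) : initPattern R x z := htr _ _ _ h h'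

theorem last_entry_eq_zero (A : patternGroup F (m + 1) R hlt htr) (y : Fin m) :
    A.1.1 (Fin.last m) y.castSucc = 0 :=
  A.2.2 _ _ (Fin.castSucc_lt_last y).ne' fun h => lt_asymm (hlt _ _ h) (Fin.castSucc_lt_last y)

/-- Deletion of the last row and column. -/
noncomputable def initHom (hlt : ∀ x y, R x y → x < y) (htr : ∀ x y z, R x y → R y z → R x z) :
    patternGroup F (m + 1) R hlt htr →*
      patternGroup F m (initPattern R) (init_lt hlt) (init_trans htr) where
  toFun A := patternMk _ _ (A.1.1.submatrix Fin.castSucc Fin.castSucc) ⟨fun x => A.2.1 _,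
    fun x y hxy hR => A.2.2 _ _ (fun e => hxy (Fin.castSucc_injective _ e)) hR⟩
  map_one' := patternGroup_ext (Matrix.submatrix_one _ (Fin.castSucc_injective m))
  map_mul' A B := by
    apply patternGroup_ext
    ext x y
    change ∑ k, A.1.1 x.castSucc k * B.1.1 k y.castSucc =
      ∑ k : Fin m, A.1.1 x.castSucc k.castSucc * B.1.1 k.castSucc y.castSucc
    rw [Fin.sum_univ_castSucc, last_entry_eq_zero, mul_zero, add_zero]

theorem initHom_apply (A : patternGroup F (m + 1) R hlt htr) (x y : Fin m) :
    (initHom hlt htr A).1.1 x y = A.1.1 x.castSucc y.castSucc := rfl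

theorem eq_of_initHom_eq {A B : patternGroup F (m + 1) R hlt htr}
    (h : initHom hlt htr A = initHom hlt htr B)
    (h' : ∀ x : Fin m, A.1.1 x.castSucc (Fin.last m) = B.1.1 x.castSucc (Fin.last m)) : A = B := by
  apply patternGroup_ext
  ext x y
  refine Fin.lastCases (Fin.lastCases ?_ (fun y => ?_) y)
    (fun x => Fin.lastCases ?_ (fun y => ?_) y) x
  · exact (A.2.1 _).trans (B.2.1 _).symm
  · rw [last_entry_eq_zero, last_entry_eq_zero]
  · exact h' x
  · rw [← initHom_apply, h, initHom_apply]

theorem exists_initHom_eq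
    (B : patternGroup F m (initPattern R) (init_lt hlt) (init_trans htr)) (w : Fin m → F)
    (hw : ∀ x, ¬ R x.castSucc (Fin.last m) → w x = 0) :
    ∃ A, initHom hlt htr A = B ∧ ∀ x : Fin m, A.1.1 x.castSucc (Fin.last m) = w x := by
  let M : Matrix (Fin (m + 1)) (Fin (m + 1)) F := Matrix.of fun x y =>
    Fin.lastCases (motive := fun _ => F) (Fin.lastCases (motive := fun _ => F) 1 (fun _ => 0) y)
      (fun x => Fin.lastCases (motive := fun _ => F) (w x) (fun y => B.1.1 x y) y) x
  have hM : IsPatternMatrix R M := by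
    constructor
    · intro x
      refine Fin.lastCases ?_ (fun x => ?_) x
      · simp [M]
      · simpa [M] using B.2.1 x
    · intro x y
      refine Fin.lastCases (Fin.lastCases ?_ (fun y => ?_) y)
        (fun x => Fin.lastCases ?_ (fun y => ?_) y) x
      · exact fun h => absurd rfl h
      · intro _ _
        simp [M]
      · intro _ h
        simpa [M] using hw x h
      · intro hxy hR
        simpa [M] using B.2.2 x y (fun e => hxy (congrArg _ e)) hR
  refine ⟨patternMk _ _ M hM, patternGroup_ext ?_, fun x => ?_⟩
  · ext x y
    rw [initHom_apply, patternMk_val]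
    simp [M]
  · rw [patternMk_val]
    simp [M]

/-- A trivial last column can be deleted. -/
theorem numIrr_of_last_column_trivial (h0 : ∀ x : Fin m, ¬ R x.castSucc (Fin.last m)) (r : ℚ) :
    numIrr (patternGroup F (m + 1) R hlt htr) r =
      numIrr (patternGroup F m (initPattern R) (init_lt hlt) (init_trans htr)) r := by
  refine numIrr_congr (MulEquiv.ofBijective (initHom hlt htr) ⟨fun A B h => ?_, fun B => ?_⟩) r
  · refine eq_of_initHom_eq h fun x => ?_
    rw [A.2.2 _ _ (Fin.castSucc_lt_last x).ne (h0 x), B.2.2 _ _ (Fin.castSucc_lt_last x).ne (h0 x)]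
  · obtain ⟨A, hA, -⟩ := exists_initHom_eq B 0 fun _ _ => rfl
    exact ⟨A, hA⟩

/-- A last column with one position of the pattern, whose row number is that of a trivial column,
splits off as a direct factor. -/
theorem numIrr_of_last_column_single (i : Fin m)
    (h1 : ∀ x : Fin m, R x.castSucc (Fin.last m) ↔ x = i) (r : ℚ) :
    numIrr (patternGroup F (m + 1) R hlt htr) r = Nat.card F *
      numIrr (patternGroup F m (initPattern R) (init_lt hlt) (init_trans htr)) r := by
  classical
  have hz : ∀ (A : patternGroup F (m + 1) R hlt htr) (x : Fin m), x ≠ i →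
      A.1.1 x.castSucc (Fin.last m) = 0 := fun A x hx =>
    A.2.2 _ _ (Fin.castSucc_lt_last x).ne fun h => hx ((h1 x).mp h)
  -- The single free entry of the last column is additive: in the product only the diagonal terms at
  -- row `i` and at the last index contribute.
  let f : patternGroup F (m + 1) R hlt htr →* Multiplicative F :=
    { toFun := fun A => Multiplicative.ofAdd (A.1.1 i.castSucc (Fin.last m))
      map_one' := by
        change Multiplicative.ofAdd ((1 : Matrix _ _ F) _ _) = 1
        rw [Matrix.one_apply_ne (Fin.castSucc_lt_last i).ne]
        rfl
      map_mul' := fun A B => by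
        rw [← ofAdd_add]
        congr 1
        change ∑ k, A.1.1 i.castSucc k * B.1.1 k (Fin.last m) = _
        rw [Fin.sum_univ_castSucc, Finset.sum_eq_single i]
        · rw [A.2.1, B.2.1, one_mul, mul_one, add_comm]
        · intro k _ hk
          rw [hz B k hk, mul_zero]
        · exact fun h => absurd (Finset.mem_univ _) h }
  rw [← numIrr_prod_multiplicative]
  refine numIrr_congr (MulEquiv.ofBijective ((initHom hlt htr).prod f)
    ⟨fun A B h => ?_, fun ⟨B, a⟩ => ?_⟩) r
  · refine eq_of_initHom_eq (congrArg Prod.fst h) fun x => ?_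
    by_cases hx : x = i
    · subst hx
      exact congrArg (fun p => Multiplicative.toAdd p.2) h
    · rw [hz A x hx, hz B x hx]
  · obtain ⟨A, hA, hA'⟩ := exists_initHom_eq B (Pi.single i a.toAdd) fun x hx => by
      rw [Pi.single_eq_of_ne fun e => hx ((h1 x).mpr e)]
    refine ⟨A, Prod.ext hA ?_⟩
    change Multiplicative.ofAdd (A.1.1 i.castSucc (Fin.last m)) = a
    rw [hA', Pi.single_eq_same]
    rfl

end LastColumn

theorem numIrr_patternGroup_congr (F : Type*) [Field F] [Finite F] {m : ℕ}
    {R R' : Fin m → Fin m → Prop} (hlt : ∀ x y, R x y → x < y)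
    (htr : ∀ x y z, R x y → R y z → R x z) (hlt' : ∀ x y, R' x y → x < y)
    (htr' : ∀ x y z, R' x y → R' y z → R' x z) (h : ∀ x y, R x y ↔ R' x y) (r : ℚ) :
    numIrr (patternGroup F m R hlt htr) r = numIrr (patternGroup F m R' hlt' htr') r := by
  rw [patternGroup_congr hlt htr hlt' htr' h]

/-! ### Recursions for the groups U and P -/

section Recursions

variable (F : Type*) [Field F] [Finite F]

theorem colTriv_one (m : ℕ) : colTriv F m 1 = unitri F m := by
  refine patternGroup_congr _ _ _ _ fun x y => ⟨And.left, fun h => ⟨h, ?_⟩⟩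
  have : (x : ℕ) < y := h
  omega

/-- The only position above the diagonal in column 2 is in row 1, the exempt row. This is why the
pair `(1, 2)` is split off in (b). -/
theorem twoColTriv_one_two (m : ℕ) : twoColTriv F m 1 2 = unitri F m := by
  refine patternGroup_congr _ _ _ _ fun x y => ⟨And.left, fun h => ⟨h, ?_⟩⟩
  have : (x : ℕ) < y := h
  omega

theorem colTriv_inf_one (m i : ℕ) : colTriv F m i ⊓ colTriv F m 1 = colTriv F m i := by
  rw [colTriv_one, inf_eq_left]
  exact fun A hA => (mem_colTriv.mp hA).1

theorem colTriv_inf_pattern_lt (m i j : ℕ) (x y : Fin m)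
    (h : x < y ∧ (y : ℕ) + 1 ≠ i ∧ (y : ℕ) + 1 ≠ j) : x < y := h.1

theorem colTriv_inf_pattern_trans (m i j : ℕ) (x y z : Fin m)
    (h : x < y ∧ (y : ℕ) + 1 ≠ i ∧ (y : ℕ) + 1 ≠ j)
    (h' : y < z ∧ (z : ℕ) + 1 ≠ i ∧ (z : ℕ) + 1 ≠ j) :
    x < z ∧ (z : ℕ) + 1 ≠ i ∧ (z : ℕ) + 1 ≠ j := ⟨h.1.trans h'.1, h'.2⟩

theorem colTriv_inf (m i j : ℕ) : colTriv F m i ⊓ colTriv F m j =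
    patternGroup F m (fun x y => x < y ∧ (y : ℕ) + 1 ≠ i ∧ (y : ℕ) + 1 ≠ j)
      (colTriv_inf_pattern_lt m i j) (colTriv_inf_pattern_trans m i j) := by
  ext A
  constructor
  · rintro ⟨⟨h1, h2⟩, -, h3⟩
    refine ⟨h1, fun x y hxy hR => ?_⟩
    by_cases hi : x < y ∧ (y : ℕ) + 1 ≠ i
    · exact h3 x y hxy fun h => hR ⟨hi.1, hi.2, h.2⟩
    · exact h2 x y hxy hi
  · rintro ⟨h1, h2⟩
    exact ⟨⟨h1, fun x y hxy hR => h2 x y hxy fun h => hR ⟨h.1, h.2.1⟩⟩, h1,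
      fun x y hxy hR => h2 x y hxy fun h => hR ⟨h.1, h.2.2⟩⟩

theorem numIrr_colTriv_inf_last {m j : ℕ} (r : ℚ) :
    numIrr ↥(colTriv F (m + 1) (m + 1) ⊓ colTriv F (m + 1) j) r = numIrr (colTriv F m j) r := by
  rw [colTriv_inf, numIrr_of_last_column_trivial fun x h => h.2.1 rfl, colTriv]
  refine numIrr_patternGroup_congr F _ _ _ _
    (fun x y => ⟨fun h => ⟨h.1, h.2.2⟩, fun h => ⟨h.1, ?_, h.2⟩⟩) r
  exact fun e => absurd y.2 (by simp at e; omega)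

theorem numIrr_twoColTriv_last {m i : ℕ} (hi : 1 ≤ i) (him : i ≤ m) (r : ℚ) :
    numIrr (twoColTriv F (m + 1) i (m + 1)) r = Nat.card F * numIrr (colTriv F m i) r := by
  have hsub : i - 1 < m := by omega
  rw [twoColTriv, numIrr_of_last_column_single (⟨i - 1, hsub⟩ : Fin m) fun x => ?_]
  · congr 1
    rw [colTriv]
    refine numIrr_patternGroup_congr F _ _ _ _ (fun x y => ⟨fun h => ⟨h.1, h.2.1⟩,
      fun h => ⟨h.1, h.2, fun e => ?_⟩⟩) r
    exact absurd y.2 (by simp at e; omega)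
  · rw [Fin.ext_iff]
    refine ⟨fun h => ?_, fun h => ⟨Fin.castSucc_lt_last x, ?_, fun _ => ?_⟩⟩
    · have := h.2.2 rfl
      simp at this ⊢
      omega
    · simp at h ⊢
      omega
    · simp at h ⊢
      omega

theorem sum_firstRow {m : ℕ} {R : Fin (m + 1) → Fin (m + 1) → Prop} [Fintype (FirstRow R)]
    (P : ℕ → Prop) [DecidablePred P] (hP : ∀ j : Fin m, R 0 j.succ ↔ P (j + 1)) (g : ℕ → ℕ) :
    ∑ j : FirstRow R, g (j.1 + 1) = ∑ j ∈ Finset.Icc 1 m with P j, g j := by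
  refine Finset.sum_bij (fun j _ => j.1.1 + 1) (fun j _ => ?_) (fun j _ k _ h => ?_)
    (fun k hk => ?_) fun _ _ => rfl
  · rw [Finset.mem_filter, Finset.mem_Icc]
    have := j.1.2
    exact ⟨by omega, (hP _).mp j.2⟩
  · exact Subtype.ext (Fin.ext (by omega))
  · rw [Finset.mem_filter, Finset.mem_Icc] at hk
    obtain ⟨l, rfl⟩ : ∃ l, k = l + 1 := ⟨k - 1, by omega⟩
    exact ⟨⟨⟨l, by omega⟩, (hP _).mpr hk.2⟩, Finset.mem_univ _, rfl⟩

theorem card_firstRow_lt {m : ℕ} {R : Fin (m + 1) → Fin (m + 1) → Prop}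
    (P : ℕ → Prop) [DecidablePred P] (hP : ∀ j : Fin m, R 0 j.succ ↔ P (j + 1)) (j : FirstRow R) :
    Nat.card {x : FirstRow R // x < j} = ((Finset.range j).filter fun x => P (x + 1)).card := by
  classical
  have := Fintype.ofFinite {x : FirstRow R // x < j}
  rw [Nat.card_eq_fintype_card, ← Finset.card_univ]
  refine Finset.card_bij (fun x _ => x.1.1.1) (fun x _ => ?_) (fun x _ y _ h => ?_) fun k hk => ?_
  · rw [Finset.mem_filter, Finset.mem_range]
    exact ⟨x.2, (hP _).mp x.1.2⟩
  · exact Subtype.ext (Subtype.ext (Fin.ext h))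
  · rw [Finset.mem_filter, Finset.mem_range] at hk
    exact ⟨⟨⟨⟨k, hk.1.trans j.1.2⟩, (hP _).mpr hk.2⟩, hk.1⟩, Finset.mem_univ _, rfl⟩

theorem numIrr_unitri_succ (m : ℕ) (r : ℚ) :
    numIrr (unitri F (m + 1)) r = numIrr (unitri F m) r + (Nat.card F - 1) *
      ∑ j ∈ Finset.Icc 1 m, numIrr (colTriv F m j) (r / (Nat.card F : ℚ) ^ (j - 1)) := by
  classical
  rw [unitri, numIrr_patternGroup_succ (F := F)]
  · congr 1
    · rw [unitri]
      exact numIrr_patternGroup_congr F _ _ _ _ (fun x y => Fin.succ_lt_succ_iff) r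
    · congr 1
      have h := sum_firstRow (m := m) (R := fun x y => x < y) (fun _ => True)
        (fun j => iff_true_intro (Fin.succ_pos j))
        fun j => numIrr (colTriv F m j) (r / (Nat.card F : ℚ) ^ (j - 1))
      rw [Finset.filter_true] at h
      rw [← h]
      refine Finset.sum_congr rfl fun j _ => ?_
      rw [card_firstRow_lt (fun _ => True) (fun j => iff_true_intro (Fin.succ_pos j)),
        Finset.filter_true, Finset.card_range, Nat.add_sub_cancel, colTriv]
      refine numIrr_patternGroup_congr F _ _ _ _ (fun x y =>
        ⟨fun h => ⟨Fin.succ_lt_succ_iff.mp h.1, ?_⟩,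
          fun h => ⟨Fin.succ_lt_succ_iff.mpr h.1, ?_⟩⟩) _
      · exact fun e => h.2 (Fin.ext (by omega)) (Fin.succ_pos x)
      · exact fun e => absurd (congrArg Fin.val e) (by have := h.2; omega)
  · exact fun x y _ _ h => Fin.succ_lt_succ_iff.mpr h

/-- Column `i + 1` becomes column `i` of the tail, and `i` is missing from the first row. For `j <
i` row `i` lies below position `j` and has no effect. For `i < j` the entry `(i, j)` survives in the
stabilizer and the orbit loses one coordinate, hence `Q` and the exponent `j - 2`. -/
theorem numIrr_colTriv_succ {m i : ℕ} (hi : 1 ≤ i) (r : ℚ) :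
    numIrr (colTriv F (m + 1) (i + 1)) r = numIrr (colTriv F m i) r + (Nat.card F - 1) *
      (∑ j ∈ Finset.Icc 1 m with j < i,
          numIrr ↥(colTriv F m i ⊓ colTriv F m j) (r / (Nat.card F : ℚ) ^ (j - 1)) +
        ∑ j ∈ Finset.Icc 1 m with i < j,
          numIrr (twoColTriv F m i j) (r / (Nat.card F : ℚ) ^ (j - 2))) := by
  classical
  have hP : ∀ j : Fin m, (0 < j.succ ∧ (j.succ : ℕ) + 1 ≠ i + 1) ↔ (j : ℕ) + 1 ≠ i := fun j => by
    rw [Fin.val_succ]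
    exact ⟨fun h e => h.2 (by omega), fun h => ⟨Fin.succ_pos j, by omega⟩⟩
  rw [colTriv, numIrr_patternGroup_succ (F := F)]
  · congr 1
    · rw [colTriv]
      refine numIrr_patternGroup_congr F _ _ _ _ (fun x y => ?_) r
      rw [tailPattern, Fin.succ_lt_succ_iff, Fin.val_succ]
      omega
    · congr 1
      have h := sum_firstRow (m := m) (R := fun x y => x < y ∧ (y : ℕ) + 1 ≠ i + 1) (· ≠ i) hP
        fun j => if j < i then
            numIrr ↥(colTriv F m i ⊓ colTriv F m j) (r / (Nat.card F : ℚ) ^ (j - 1))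
          else numIrr (twoColTriv F m i j) (r / (Nat.card F : ℚ) ^ (j - 2))
      rw [Finset.sum_ite (s := Finset.filter _ _), Finset.filter_filter,
        Finset.filter_filter] at h
      have e1 : (Finset.Icc 1 m).filter (fun j => j ≠ i ∧ j < i) =
          (Finset.Icc 1 m).filter (· < i) :=
        Finset.filter_congr fun j _ => by omega
      have e2 : (Finset.Icc 1 m).filter (fun j => j ≠ i ∧ ¬ j < i) =
          (Finset.Icc 1 m).filter (i < ·) :=
        Finset.filter_congr fun j _ => by omega
      rw [e1, e2] at h
      rw [← h]
      refine Finset.sum_congr rfl fun j _ => ?_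
      have hj := (hP j.1).mp j.2
      rw [card_firstRow_lt (· ≠ i) hP]
      split_ifs with hlt
      · have hc : (Finset.range j.1).filter (fun x => x + 1 ≠ i) = Finset.range j.1 :=
          Finset.filter_true_of_mem fun x hx => by
            rw [Finset.mem_range] at hx
            omega
        rw [hc, Finset.card_range, Nat.add_sub_cancel, colTriv_inf]
        refine numIrr_patternGroup_congr F _ _ _ _ (fun x y => ?_) _
        rw [columnPattern, Fin.succ_lt_succ_iff, Fin.val_succ, hP, Fin.ext_iff, Fin.lt_def]
        omega
      -- Column `i` has zero-based index `i - 1`; here it lies before `j`, so one coordinate is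
      -- removed from the count.
      · have hc : (Finset.range j.1).filter (fun x => x + 1 ≠ i) =
            (Finset.range j.1).erase (i - 1) := by
          ext x
          rw [Finset.mem_filter, Finset.mem_erase, Finset.mem_range]
          omega
        rw [hc, Finset.card_erase_of_mem (Finset.mem_range.mpr (by omega)), Finset.card_range]
        rw [show (j.1 : ℕ) + 1 - 2 = j.1 - 1 by omega, twoColTriv]
        refine numIrr_patternGroup_congr F _ _ _ _ (fun x y => ?_) _
        rw [columnPattern, Fin.succ_lt_succ_iff, Fin.val_succ, hP, Fin.ext_iff, Fin.lt_def]
        omega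
  · exact fun x y _ hy h => ⟨Fin.succ_lt_succ_iff.mpr h, hy.2⟩

end Recursions

/-! ### The two-step recursion and its border terms -/

section FinalRecursions

variable (F : Type*) [Field F] [Finite F]

theorem cast_card_sub_one : ((Nat.card F - 1 : ℕ) : ℤ) = Nat.card F - 1 := by
  have : 0 < Nat.card F := Nat.card_pos
  push_cast [Nat.cast_sub (show 1 ≤ Nat.card F from this)]
  rfl

theorem int_numIrr_unitri_succ (m : ℕ) (r : ℚ) :
    (numIrr (unitri F (m + 1)) r : ℤ) = numIrr (unitri F m) r + ((Nat.card F : ℤ) - 1) *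
      ∑ j ∈ Finset.Icc 1 m, (numIrr (colTriv F m j) (r / (Nat.card F : ℚ) ^ (j - 1)) : ℤ) := by
  rw [numIrr_unitri_succ, Nat.cast_add, Nat.cast_mul, cast_card_sub_one, Nat.cast_sum]

theorem int_numIrr_colTriv_succ {m i : ℕ} (hi : 1 ≤ i) (r : ℚ) :
    (numIrr (colTriv F (m + 1) (i + 1)) r : ℤ) = numIrr (colTriv F m i) r +
      ((Nat.card F : ℤ) - 1) *
      (∑ j ∈ Finset.Icc 1 m with j < i,
          (numIrr ↥(colTriv F m i ⊓ colTriv F m j) (r / (Nat.card F : ℚ) ^ (j - 1)) : ℤ) +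
        ∑ j ∈ Finset.Icc 1 m with i < j,
          (numIrr (twoColTriv F m i j) (r / (Nat.card F : ℚ) ^ (j - 2)) : ℤ)) := by
  rw [numIrr_colTriv_succ F hi, Nat.cast_add, Nat.cast_mul, cast_card_sub_one, Nat.cast_add,
    Nat.cast_sum, Nat.cast_sum]

theorem sum_Icc_one_succ {M : Type*} [AddCommMonoid M] (m : ℕ) (f : ℕ → M) :
    ∑ j ∈ Finset.Icc 1 (m + 1), f j = f 1 + ∑ j ∈ Finset.Icc 1 m, f (j + 1) := by
  have h := Finset.sum_Ioc_add_eq_sum_Icc (f := f) (show 1 ≤ m + 1 by omega)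
  rw [← h, add_comm]
  congr 1
  refine (Finset.sum_bij (fun j _ => j + 1) (fun j hj => ?_) (fun _ _ _ _ h => by omega)
    (fun k hk => ?_) fun _ _ => rfl).symm
  · rw [Finset.mem_Icc] at hj
    rw [Finset.mem_Ioc]
    omega
  · rw [Finset.mem_Ioc] at hk
    exact ⟨k - 1, by rw [Finset.mem_Icc]; omega, by omega⟩

theorem sum_pairs_eq {M : Type*} [AddCommMonoid M] (s : Finset ℕ) (P : ℕ → ℕ → Prop)
    [∀ a, DecidablePred (P a)] [DecidablePred fun i : ℕ × ℕ => P i.1 i.2] (f : ℕ → ℕ → M) :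
    ∑ i ∈ s ×ˢ s with P i.1 i.2, f i.1 i.2 = ∑ a ∈ s, ∑ b ∈ s with P a b, f a b := by
  rw [Finset.sum_filter, Finset.sum_product]
  refine Finset.sum_congr rfl fun a _ => ?_
  rw [Finset.sum_filter]
  refine Finset.sum_congr rfl fun b _ => ?_
  congr

/-- The recursion for `U` read backwards; it collapses every weighted sum over the groups `P` to a
difference of two terms for `U`. -/
theorem sum_numIrr_colTriv (m : ℕ) (r : ℚ) :
    ((Nat.card F : ℤ) - 1) * ∑ j ∈ Finset.Icc 1 m,
        (numIrr (colTriv F m j) (r / (Nat.card F : ℚ) ^ (j - 1)) : ℤ) =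
      numIrr (unitri F (m + 1)) r - numIrr (unitri F m) r := by
  rw [int_numIrr_unitri_succ, add_sub_cancel_left]

theorem div_pow_div_pow {q : ℚ} {r : ℚ} (a b c : ℕ) (h : a + b = c) :
    r / q ^ a / q ^ b = r / q ^ c := by
  rw [div_div, ← pow_add, h]

theorem numIrr_unitri_add_two (m : ℕ) (r : ℚ) :
    (numIrr (unitri F (m + 2)) r : ℤ) =
      Nat.card F * numIrr (unitri F (m + 1)) r
      + numIrr (unitri F (m + 1)) (r / Nat.card F)
      - numIrr (unitri F m) (r / Nat.card F)
      + ((Nat.card F : ℤ) - 1) ^ 2 *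
        ∑ i ∈ Finset.Icc 1 m, ∑ j ∈ Finset.Icc 1 m with j < i,
          (numIrr ↥(colTriv F m i ⊓ colTriv F m j) (r / (Nat.card F : ℚ) ^ (i + j - 1)) : ℤ)
      + ((Nat.card F : ℤ) - 1) ^ 2 *
        ∑ i ∈ Finset.Icc 1 m, ∑ j ∈ Finset.Icc 1 m with i < j,
          (numIrr (twoColTriv F m i j) (r / (Nat.card F : ℚ) ^ (i + j - 2)) : ℤ) := by
  -- The term `j = 1` is `U_{m+1}` itself and raises its coefficient from 1 to `q`; the other terms
  -- are `P_{m+1,i+1}`, open to the second recursion.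
  rw [int_numIrr_unitri_succ F (m + 1), sum_Icc_one_succ, colTriv_one, Nat.sub_self, pow_zero,
    div_one]
  have h1 : ∀ i ∈ Finset.Icc 1 m,
      (numIrr (colTriv F (m + 1) (i + 1)) (r / (Nat.card F : ℚ) ^ (i + 1 - 1)) : ℤ) =
      numIrr (colTriv F m i) (r / Nat.card F / (Nat.card F : ℚ) ^ (i - 1)) +
      ((Nat.card F : ℤ) - 1) * (∑ j ∈ Finset.Icc 1 m with j < i,
          (numIrr ↥(colTriv F m i ⊓ colTriv F m j) (r / (Nat.card F : ℚ) ^ (i + j - 1)) : ℤ) +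
        ∑ j ∈ Finset.Icc 1 m with i < j,
          (numIrr (twoColTriv F m i j) (r / (Nat.card F : ℚ) ^ (i + j - 2)) : ℤ)) := fun i hi => by
    rw [Finset.mem_Icc] at hi
    rw [int_numIrr_colTriv_succ F hi.1, Nat.add_sub_cancel]
    congr 1
    · congr 2
      conv_rhs => rw [← pow_one (Nat.card F : ℚ), pow_one, div_div, ← pow_succ']
      congr 2
      omega
    · congr 1
      congr 1
      · refine Finset.sum_congr rfl fun j hj => ?_
        rw [Finset.mem_filter, Finset.mem_Icc] at hj
        rw [div_pow_div_pow i (j - 1) (i + j - 1) (by omega)]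
      · refine Finset.sum_congr rfl fun j hj => ?_
        rw [Finset.mem_filter, Finset.mem_Icc] at hj
        rw [div_pow_div_pow i (j - 2) (i + j - 2) (by omega)]
  rw [Finset.sum_congr rfl h1, Finset.sum_add_distrib, ← Finset.mul_sum, Finset.sum_add_distrib]
  linear_combination sum_numIrr_colTriv F m (r / Nat.card F)

theorem sum_Icc_one_add_two {M : Type*} [AddCommMonoid M] (m : ℕ) (f : ℕ → M) :
    ∑ j ∈ Finset.Icc 1 (m + 2), f j = f 1 + f (m + 2) + ∑ j ∈ Finset.Icc 2 (m + 1), f j := by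
  have h : Finset.Icc 1 (m + 2) = insert 1 (insert (m + 2) (Finset.Icc 2 (m + 1))) := by
    ext j
    simp only [Finset.mem_insert, Finset.mem_Icc]
    omega
  rw [h, Finset.sum_insert, Finset.sum_insert, add_assoc]
  · simp
  · simp

/-- Pairs in a triangle, sorted by whether they meet the border. -/
theorem sum_lt_Icc_add_two (m : ℕ) (f : ℕ → ℕ → ℤ) :
    ∑ i ∈ Finset.Icc 1 (m + 2), ∑ j ∈ Finset.Icc 1 (m + 2) with j < i, f i j =
      ∑ i ∈ Finset.Icc 2 (m + 2), f i 1 + ∑ j ∈ Finset.Icc 2 (m + 1), f (m + 2) j +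
        ∑ i ∈ Finset.Icc 2 (m + 1), ∑ j ∈ Finset.Icc 2 (m + 1) with j < i, f i j := by
  have h1 : (Finset.Icc 1 (m + 2)).filter (· < 1) = ∅ := by
    refine Finset.filter_false_of_mem fun j hj => ?_
    rw [Finset.mem_Icc] at hj
    omega
  have h2 : (Finset.Icc 1 (m + 2)).filter (· < m + 2) = insert 1 (Finset.Icc 2 (m + 1)) := by
    ext j
    simp only [Finset.mem_filter, Finset.mem_Icc, Finset.mem_insert]
    omega
  have h3 : ∀ i ∈ Finset.Icc 2 (m + 1), (Finset.Icc 1 (m + 2)).filter (· < i) =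
      insert 1 ((Finset.Icc 2 (m + 1)).filter (· < i)) := fun i hi => by
    rw [Finset.mem_Icc] at hi
    ext j
    simp only [Finset.mem_filter, Finset.mem_Icc, Finset.mem_insert]
    omega
  have h4 : Finset.Icc 2 (m + 2) = insert (m + 2) (Finset.Icc 2 (m + 1)) := by
    ext j
    simp only [Finset.mem_Icc, Finset.mem_insert]
    omega
  have h5 : ∀ i ∈ Finset.Icc 2 (m + 1), ∑ j ∈ Finset.Icc 1 (m + 2) with j < i, f i j =
      f i 1 + ∑ j ∈ Finset.Icc 2 (m + 1) with j < i, f i j := fun i hi => by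
    rw [h3 i hi, Finset.sum_insert (by simp)]
  rw [sum_Icc_one_add_two, h1, Finset.sum_empty, h2, Finset.sum_insert (by simp),
    Finset.sum_congr rfl h5, Finset.sum_add_distrib, h4, Finset.sum_insert (by simp)]
  ring

theorem sum_gt_Icc_succ (m : ℕ) (f : ℕ → ℕ → ℤ) :
    ∑ i ∈ Finset.Icc 1 (m + 1), ∑ j ∈ Finset.Icc 1 (m + 1) with i < j, f i j =
      ∑ i ∈ Finset.Icc 1 m, f i (m + 1) +
        ∑ i ∈ Finset.Icc 1 m, ∑ j ∈ Finset.Icc 1 m with i < j, f i j := by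
  have h1 : (Finset.Icc 1 (m + 1)).filter (m + 1 < ·) = ∅ := by
    refine Finset.filter_false_of_mem fun j hj => ?_
    rw [Finset.mem_Icc] at hj
    omega
  have h2 : ∀ i ∈ Finset.Icc 1 m, (Finset.Icc 1 (m + 1)).filter (i < ·) =
      insert (m + 1) ((Finset.Icc 1 m).filter (i < ·)) := fun i hi => by
    rw [Finset.mem_Icc] at hi
    ext j
    simp only [Finset.mem_filter, Finset.mem_Icc, Finset.mem_insert]
    omega
  rw [Finset.sum_Icc_succ_top (by omega), h1, Finset.sum_empty, add_zero,
    ← Finset.sum_add_distrib]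
  refine Finset.sum_congr rfl fun i hi => ?_
  rw [h2 i hi, Finset.sum_insert (by simp)]

/-- The recursion with the border terms of the two sums evaluated. -/
theorem numIrr_unitri_add_four (m : ℕ) (hm : 1 ≤ m) (r : ℚ) :
    (numIrr (unitri F (m + 4)) r : ℤ) =
      Nat.card F * numIrr (unitri F (m + 3)) r
      + Nat.card F * numIrr (unitri F (m + 3)) (r / Nat.card F)
      - Nat.card F * numIrr (unitri F (m + 2)) (r / Nat.card F)
      + ((Nat.card F : ℤ) - 1) *
        (numIrr (unitri F (m + 2)) (r / (Nat.card F : ℚ) ^ (m + 2))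
          - Nat.card F * numIrr (unitri F (m + 1)) (r / (Nat.card F : ℚ) ^ (m + 2))
          + Nat.card F * numIrr (unitri F (m + 2)) (r / (Nat.card F : ℚ) ^ (m + 1))
          - Nat.card F * numIrr (unitri F (m + 1)) (r / (Nat.card F : ℚ) ^ (m + 1)))
      + ((Nat.card F : ℤ) - 1) ^ 2 *
        ∑ i ∈ Finset.Icc 2 (m + 1), ∑ j ∈ Finset.Icc 2 (m + 1) with j < i,
          (numIrr ↥(colTriv F (m + 2) i ⊓ colTriv F (m + 2) j)
            (r / (Nat.card F : ℚ) ^ (i + j - 1)) : ℤ)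
      + ((Nat.card F : ℤ) - 1) ^ 2 *
        (∑ i ∈ Finset.Icc 1 (m + 1), ∑ j ∈ Finset.Icc 1 (m + 1) with i < j,
          (numIrr (twoColTriv F (m + 2) i j) (r / (Nat.card F : ℚ) ^ (i + j - 2)) : ℤ)
          - numIrr (unitri F (m + 2)) (r / Nat.card F)) := by
  -- Leaving out `j = 1` subtracts a further `(q - 1) N(U_n)`, so the coefficient of `N(U_n)`
  -- becomes `q`. For `n = 0` there is no such term to leave out.
  have hc1 : ∀ n : ℕ, ∀ s : ℚ, ((Nat.card F : ℤ) - 1) * ∑ j ∈ Finset.Icc 2 n,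
      (numIrr (colTriv F n j) (s / (Nat.card F : ℚ) ^ (j - 1)) : ℤ) =
      numIrr (unitri F (n + 1)) s - Nat.card F * numIrr (unitri F n) s ∨ n = 0 := fun n s => by
    rcases Nat.eq_zero_or_pos n with hn | hn
    · exact Or.inr hn
    · left
      have h := sum_numIrr_colTriv F n s
      rw [← Finset.sum_Ioc_add_eq_sum_Icc (show 1 ≤ n from hn), colTriv_one, Nat.sub_self, pow_zero,
        div_one] at h
      change _ * (∑ j ∈ Finset.Icc 2 n, _ + _) = _ at h
      linear_combination h
  -- Three borders: `hA` has second index 1, `hB` has the last column trivial, and `hC` has the last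
  -- column as a direct factor, whence its factor `q`.
  have hA : ∑ i ∈ Finset.Icc 2 (m + 2), (numIrr ↥(colTriv F (m + 2) i ⊓ colTriv F (m + 2) 1)
      (r / (Nat.card F : ℚ) ^ (i + 1 - 1)) : ℤ) = ∑ i ∈ Finset.Icc 2 (m + 2),
      (numIrr (colTriv F (m + 2) i) (r / Nat.card F / (Nat.card F : ℚ) ^ (i - 1)) : ℤ) := by
    refine Finset.sum_congr rfl fun i hi => ?_
    rw [Finset.mem_Icc] at hi
    rw [colTriv_inf_one, div_div, ← pow_succ']
    congr 4
    omega
  have hB : ∑ j ∈ Finset.Icc 2 (m + 1), (numIrr ↥(colTriv F (m + 2) (m + 2) ⊓ colTriv F (m + 2) j)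
      (r / (Nat.card F : ℚ) ^ (m + 2 + j - 1)) : ℤ) = ∑ j ∈ Finset.Icc 2 (m + 1),
      (numIrr (colTriv F (m + 1) j)
        (r / (Nat.card F : ℚ) ^ (m + 2) / (Nat.card F : ℚ) ^ (j - 1)) : ℤ) := by
    refine Finset.sum_congr rfl fun j hj => ?_
    rw [Finset.mem_Icc] at hj
    rw [div_pow_div_pow (m + 2) (j - 1) (m + 2 + j - 1) (by omega),
      numIrr_colTriv_inf_last F (m := m + 1)]
  have hC : ∑ i ∈ Finset.Icc 1 (m + 1), (numIrr (twoColTriv F (m + 2) i (m + 1 + 1))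
      (r / (Nat.card F : ℚ) ^ (i + (m + 1 + 1) - 2)) : ℤ) = Nat.card F *
      ∑ i ∈ Finset.Icc 1 (m + 1), (numIrr (colTriv F (m + 1) i)
        (r / (Nat.card F : ℚ) ^ (m + 1) / (Nat.card F : ℚ) ^ (i - 1)) : ℤ) := by
    rw [Finset.mul_sum]
    refine Finset.sum_congr rfl fun i hi => ?_
    rw [Finset.mem_Icc] at hi
    rw [div_pow_div_pow (m + 1) (i - 1) (i + (m + 1 + 1) - 2) (by omega),
      numIrr_twoColTriv_last F hi.1 hi.2, Nat.cast_mul]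
  rw [numIrr_unitri_add_two F (m + 2), sum_lt_Icc_add_two, sum_gt_Icc_succ (m + 1), hA, hB, hC]
  have e1 := (hc1 (m + 2) (r / Nat.card F)).resolve_right (by omega)
  have e2 := (hc1 (m + 1) (r / (Nat.card F : ℚ) ^ (m + 2))).resolve_right (by omega)
  have e3 := sum_numIrr_colTriv F (m + 1) (r / (Nat.card F : ℚ) ^ (m + 1))
  linear_combination ((Nat.card F : ℤ) - 1) * e1 + ((Nat.card F : ℤ) - 1) * e2 +
    ((Nat.card F : ℤ) - 1) * Nat.card F * e3

end FinalRecursions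

/-! ### Both formulas in their stated form -/

theorem mainTheorem3 (F : Type*) [Field F] [Finite F] (q : ℕ) (hq : Nat.card F = q) :
    (∀ n : ℕ, 4 ≤ n → ∀ k : ℤ,
      (numIrr (unitri F n) k : ℤ) =
        q * numIrr (unitri F (n - 1)) k
        + numIrr (unitri F (n - 1)) (k / q)
        - numIrr (unitri F (n - 2)) (k / q)
        + (q - 1) ^ 2 *
          ∑ i ∈ Finset.Icc 1 (n - 2) ×ˢ Finset.Icc 1 (n - 2) with i.2 < i.1,
            (numIrr ↥(colTriv F (n - 2) i.1 ⊓ colTriv F (n - 2) i.2)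
              (k / q ^ (i.1 + i.2 - 1)) : ℤ)
        + (q - 1) ^ 2 *
          ∑ i ∈ Finset.Icc 1 (n - 2) ×ˢ Finset.Icc 1 (n - 2) with i.1 < i.2,
            (numIrr (twoColTriv F (n - 2) i.1 i.2) (k / q ^ (i.1 + i.2 - 2)) : ℤ)) ∧
    (∀ n : ℕ, 5 ≤ n → ∀ k : ℤ,
      (numIrr (unitri F n) k : ℤ) =
        q * numIrr (unitri F (n - 1)) k
        + q * numIrr (unitri F (n - 1)) (k / q)
        - q * numIrr (unitri F (n - 2)) (k / q)
        + (q - 1) *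
          (numIrr (unitri F (n - 2)) (k / q ^ (n - 2))
            - q * numIrr (unitri F (n - 3)) (k / q ^ (n - 2))
            + q * numIrr (unitri F (n - 2)) (k / q ^ (n - 3))
            - q * numIrr (unitri F (n - 3)) (k / q ^ (n - 3)))
        + (q - 1) ^ 2 *
          ∑ i ∈ Finset.Icc 2 (n - 3) ×ˢ Finset.Icc 2 (n - 3) with i.2 < i.1,
            (numIrr ↥(colTriv F (n - 2) i.1 ⊓ colTriv F (n - 2) i.2)
              (k / q ^ (i.1 + i.2 - 1)) : ℤ)
        + (q - 1) ^ 2 *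
          ∑ i ∈ Finset.Icc 1 (n - 3) ×ˢ Finset.Icc 1 (n - 3) with i.1 < i.2 ∧ i ≠ (1, 2),
            (numIrr (twoColTriv F (n - 2) i.1 i.2) (k / q ^ (i.1 + i.2 - 2)) : ℤ)) := by
  subst hq
  constructor
  · intro n hn k
    obtain ⟨m, rfl⟩ : ∃ m, n = m + 2 := ⟨n - 2, by omega⟩
    rw [numIrr_unitri_add_two, ← sum_pairs_eq _ (fun i j => j < i), ← sum_pairs_eq _ (· < ·)]
    rfl
  · intro n hn k
    obtain ⟨m, rfl⟩ : ∃ m, n = m + 4 := ⟨n - 4, by omega⟩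
    -- The pair lies in the range because `n ≥ 5` gives `n - 3 ≥ 2`. Its term is `N(U_{n-2})` at `k
    -- / q`, which (b) has absorbed into the coefficient `-q`.
    have hmem : ((1, 2) : ℕ × ℕ) ∈
        (Finset.Icc 1 (m + 1) ×ˢ Finset.Icc 1 (m + 1)).filter fun i => i.1 < i.2 := by
      rw [Finset.mem_filter, Finset.mem_product, Finset.mem_Icc, Finset.mem_Icc]
      omega
    have hset : (Finset.Icc 1 (m + 1) ×ˢ Finset.Icc 1 (m + 1)).filter
        (fun i => i.1 < i.2 ∧ i ≠ (1, 2)) =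
        ((Finset.Icc 1 (m + 1) ×ˢ Finset.Icc 1 (m + 1)).filter fun i => i.1 < i.2).erase
          (1, 2) := by
      ext i
      simp only [Finset.mem_filter, Finset.mem_erase]
      tauto
    have hsum := Finset.sum_erase_eq_sub (f := fun i : ℕ × ℕ => (numIrr (twoColTriv F (m + 2)
      i.1 i.2) (k / (Nat.card F : ℚ) ^ (i.1 + i.2 - 2)) : ℤ)) hmem
    rw [← hset, twoColTriv_one_two, show 1 + 2 - 2 = 1 from rfl, pow_one] at hsum
    rw [numIrr_unitri_add_four F m (by omega), ← sum_pairs_eq _ (fun i j => j < i),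
      ← sum_pairs_eq _ (· < ·), ← hsum]
    rfl
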